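/- **Setting.** Let $\mathcal X$ (prompts) and $\mathcal A$ (responses) be countable, let $\nu_0$ be a distribution on $\mathcal X$, let $\pi_{\mathrm{ref}},\pi_{\mathrm{data}}$ be policies with $\pi_{\mathrm{ref}}(a|x)>0$ for all $x,a$, and let $r^\star:\mathcal X\times\mathcal A\to[R_{\min},R_{\max}]$ with $0\le R_{\min}$ and $R_{\max}\ge\rho>0$. Write $\Delta_r(x,a,b)=r(x,a)-r(x,b)$, $\sigma(t)=1/(1+e^{-t})$, and $$J_\beta(\pi;r)=\sum_x\nu_0(x)\Big[\sum_a\pi(a|x)r(x,a)-\beta\,\mathrm{KL}(\pi(\cdot|x)\|\pi_{\mathrm{ref}}(\cdot|x))\Big],\qquad C^\pi=\sum_x\nu_0(x)\sum_a\frac{\pi(a|x)^2}{\pi_{\mathrm{data}}(a|x)},$$ $$\mathrm{Err}_\pi(r)=\mathbb E_{x\sim\nu_0,\;a,b\sim\pi(\cdot|x)}\big[(\Delta_{r^\star}(x,a,b)-\Delta_r(x,a,b))^2\big].$$ Let $\Pi$ be a finite class of policies, $C^{\max}=\max_{\pi\in\Pi}C^\pi$, and let $\mathcal R$ be a finite class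 of rewards with $|\Delta_r|\le R_{\max}-R_{\min}$ for $r\in\mathcal R$, which contains some $r$ with $\Delta_r=\Delta_{r^\star}$ and no two distinct $r_1,r_2$ with $\Delta_{r_1}=\Delta_{r_2}$. **Data.** The ranking data set consists of $N_{\mathrm{rank}}\ge1$ i.i.d. tuples $(x_i,a_i^+,a_i^-)$: $x\sim\nu_0$, $a,a'\sim\pi_{\mathrm{data}}(\cdot|x)$ independently, and $(a^+,a^-)=(a,a')$ with probability $\sigma(\Delta_{r^\star}(x,a,a'))$, otherwise $(a^+,a^-)=(a',a)$. The rating data set consists of $N_{\mathrm{rat}}\ge1$ independent tuples $(x'_j,\tilde a_j,\bar a_j,\Delta_j)$ with $x'_j\sim\nu_0$, $\tilde a_j,\bar a_j\sim\pi_{\mathrm{data}}(\cdot|x'_j)$ independently, where, conditionally on $(x'_j,\tilde a_j,\bar a_j)$, the rating gap $\Delta_j$ has mean $\Delta_{r^\star}(x'_j,\tilde a_j,\bar a_j)$ and is $\mathbb V$-subgaussian ($\mathbb V>0$), i.e. $\mathbb P(|\Delta_j-\Delta_{r^\star}|\ge t\mid x'_j,\tilde a_j,\bar a_j)\le2e^{-t^2/(2\mathbb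 V)}$ for $t\ge0$. The dependence between the two data sets is arbitrary. **Hyperparameters.** For constants $c_1,c_2>0$, $\delta\in(0,1)$ and $\beta>0$ put $$D=\frac{c_1R_{\max}^2e^{4R_{\max}}\log(|\Pi|/\delta)}{N_{\mathrm{rank}}},\quad B=\big(R_{\max}+\sqrt{\mathbb V\log(2N_{\mathrm{rat}}/\delta)}\big)^2,\quad M=\frac{c_2\,B\log(|\mathcal R|/\delta)}{N_{\mathrm{rat}}},$$ $$\alpha=(1+M/D)^{-1},\qquad\beta_1=\tfrac{1-\alpha}{\alpha}\beta,\qquad\beta'=\tfrac{\beta\beta_1}{\beta+\beta_1}$$ (so $D=\mathrm{Err_{DPO}}$ and $M=\mathrm{Err}^{\max}(\hat r_{\mathrm{rat}})$). **Algorithm** (with parameter $\gamma\ge0$, $\phi(t)=\gamma t+\log t$). Let $\hat r_{\mathrm{rat}}\in\arg\min_{r\in\mathcal R}\sum_j(\Delta_r(x'_j,\tilde a_j,\bar a_j)-\Delta_j)^2$. Let $\Pi'$ be the set of $\pi\in\Pi$ that are positive everywhere and satisfy $|\beta\Delta_{\phi(\pi/\pi_{\mathrm{ref}})}-\frac{\beta}{\beta_1}\Delta_{\hat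 r_{\mathrm{rat}}}|\le R_{\max}-R_{\min}$ everywhere. Return any $$\pi_{\mathrm{out}}\in\arg\max_{\pi\in\Pi'}\sum_{i}\log\sigma\Big(\beta\Delta_{\phi(\pi/\pi_{\mathrm{ref}})}(x_i,a_i^+,a_i^-)-\tfrac{\beta}{\beta_1}\Delta_{\hat r_{\mathrm{rat}}}(x_i,a_i^+,a_i^-)\Big).$$ **Realizability for $\gamma$.** For each $r\in\mathcal R$, $\Pi$ contains an everywhere positive policy $\pi$ with $\beta'\phi(\pi(a|x)/\pi_{\mathrm{ref}}(a|x))=(1-\alpha)r^\star(x,a)+\alpha r(x,a)+\zeta(x)$ for some function $\zeta$ of the prompt, i.e. the closed form solution of the RLHF problem with reward $(1-\alpha)r^\star+\alpha r$ and regularizer $\beta'(\gamma D_{\chi^2}+D_{\mathrm{KL}})$. **Theorem.** There are a universal constant $c_2>0$ and, for each $\rho>0$, constants $c_1,K>0$ that depend only on $\rho$, such that the following holds in every such setting. 1. With probability at least $1-\delta$, every least squares solution satisfies $\mathrm{Err}_{\pi_{\mathrm{data}}}(\hat r_{\mathrm{rat}})\le M$. 2. Let $\pi_{\mathrm{data}}=\pi_{\mathrm{ref}}$,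 let $\pi^\star\in\Pi$ be any comparator (for instance, a maximizer of the regularized objective over $\Pi$) with $C^\star:=C^{\pi^\star}<\infty$, let $\gamma=\sqrt{\dfrac{\mathrm{Err}_{\max}}{\beta^2(1-\alpha)^2C^\star}}$ with $\mathrm{Err}_{\max}=\dfrac{2DM}{D+M}$, and let realizability hold for this $\gamma$. Then, with probability at least $1-\delta$, for all possible choices of $\hat r_{\mathrm{rat}}$ and $\pi_{\mathrm{out}}$, $\mathrm{Err}_{\pi_{\mathrm{ref}}}(\hat r_{\mathrm{rat}})\le M$ and, with $C=C^\star$, $$J_{\beta'}(\pi^\star;r^\star)-J_{\beta'}(\pi_{\mathrm{out}};r^\star)\le K\sqrt{C\,\frac{DM}{D+M}},\tag{a}$$ $$J_{\beta'}(\pi^\star;r^\star)-J_{\beta'}(\pi_{\mathrm{out}};r^\star)\le K\sqrt{\frac{R_{\max}^2e^{4R_{\max}}\,B\,\log\big(|\mathcal R|(|\mathcal R|+n)/\delta\big)}{R_{\max}^2e^{4R_{\max}}N_{\mathrm{rat}}+B\,N_{\mathrm{rank}}}\,C},\tag{b}$$ where (b) holds for $n=|\Pi|$ and, whenever $|\Pi|\le|\mathcal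 R|(|\mathcal R|+|\Pi'|)$ (in particular if $|\mathcal R|=|\Pi|$), also for $n=|\Pi'|$. 3. For arbitrary $\pi_{\mathrm{data}}$ with $C^{\max}<\infty$, let $\gamma=0$ and let realizability hold for $\gamma=0$. Then, with probability at least $1-\delta$, for all possible choices of $\hat r_{\mathrm{rat}}$ and $\pi_{\mathrm{out}}$, $\mathrm{Err}_{\pi_{\mathrm{data}}}(\hat r_{\mathrm{rat}})\le M$ and, for all $\pi^\star\in\Pi$, the bounds (a) and (b) hold with $C=C^{\max}$. -/

import Mathlib

open MeasureTheory ProbabilityTheory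
open scoped ENNReal

universe u v w

namespace RDPO

noncomputable section

variable {X : Type u} {A : Type v}

/-- The response gap of a reward model: `Δ_r(x,a,b) = r(x,a) - r(x,b)`. -/
def gap (r : X → A → ℝ) (x : X) (a b : A) : ℝ := r x a - r x b

/-- The link function `φ(t) = γ t + log t` (`γ = 0`: KL regularization,
`γ > 0`: additional `χ²` regularization). -/
def phi (γ t : ℝ) : ℝ := γ * t + Real.log t

/-- The reward `φ(π(a|x) / π_ref(a|x))` induced by a policy `π`. -/
def phiRatio (γ : ℝ) (piRef pol : X → PMF A) (x : X) (a : A) : ℝ :=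
  phi γ ((pol x a).toReal / (piRef x a).toReal)

/-! ### Laws of the data -/

/-- The outcome of a Bradley-Terry comparison with reward difference `t`:
`true` with probability `σ(t)` and `false` with probability `1 - σ(t) = σ(-t)`. -/
def preference (t : ℝ) : PMF Bool :=
  PMF.ofFintype (fun z => ENNReal.ofReal (if z then Real.sigmoid t else Real.sigmoid (-t))) (by
    rw [Fintype.sum_bool, ← ENNReal.ofReal_add (by simp [Real.sigmoid_nonneg])
      (by simp [Real.sigmoid_nonneg])]
    simp [Real.sigmoid_neg])

/-- Law of `(x, a, b)` with `x ∼ ν₀` and `a, b ∼ π(·|x)` independent given `x`. -/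
def pairLaw (ν : PMF X) (pol : X → PMF A) : PMF (X × A × A) :=
  ν.bind fun x => (pol x).bind fun a => (pol x).map fun b => (x, a, b)

/-- Law of one element `(x, a⁺, a⁻)` of the ranking data set: the pair `(x, a, b)` has law
`pairLaw`, and `a` is preferred with probability `σ(r⋆(x,a) - r⋆(x,b))`. -/
def rankLaw (ν : PMF X) (piData : X → PMF A) (rStar : X → A → ℝ) : PMF (X × A × A) :=
  (pairLaw ν piData).bind fun p =>
    (preference (gap rStar p.1 p.2.1 p.2.2)).map fun z =>
      if z then (p.1, p.2.1, p.2.2) else (p.1, p.2.2, p.2.1)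

/-- `P` is a law on `ℝ` with mean `m` whose deviations from `m` are `V`-subgaussian, expressed
through the tails. (The tail bound `2 exp (-t² / (2V))` is implied both by the moment generating
function bound `E exp (s (y - m)) ≤ exp (V s² / 2)` and by the smaller tail `2 exp (-t² / V)`, so
that it covers either convention.) -/
structure IsUnbiasedSubgaussian (V m : ℝ) (P : Measure ℝ) : Prop where
  integrable : Integrable (fun y => y) P
  mean : ∫ y, y ∂P = m
  tail : ∀ t : ℝ, 0 ≤ t →
    P {y | t ≤ |y - m|} ≤ ENNReal.ofReal (2 * Real.exp (-(t ^ 2) / (2 * V)))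

/-! ### Values, divergences, concentrability, errors -/

/-- `⟨π, r⟩ = E_{x ∼ ν₀, a ∼ π(·|x)} r(x, a)`. -/
def value [MeasurableSpace X] [MeasurableSpace A]
    (ν : PMF X) (pol : X → PMF A) (r : X → A → ℝ) : ℝ :=
  ∫ x, ∫ a, r x a ∂(pol x).toMeasure ∂ν.toMeasure

/-- `D_KL(π, π_ref) = ∑ₓ ν₀(x) KL(π(·|x) ‖ π_ref(·|x))`, possibly `∞`. -/
def klAvg [MeasurableSpace A] (ν : PMF X) (pol piRef : X → PMF A) : ℝ≥0∞ :=
  ∑' x, ν x * InformationTheory.klDiv (pol x).toMeasure (piRef x).toMeasure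

/-- The regularized objective `J_β(π; r) = ⟨π, r⟩ - β D_KL(π, π_ref)`;
it is `-∞` when the divergence is infinite. -/
def objective [MeasurableSpace X] [MeasurableSpace A]
    (ν : PMF X) (piRef : X → PMF A) (β : ℝ) (r : X → A → ℝ) (pol : X → PMF A) : EReal :=
  (value ν pol r : EReal) - ((ENNReal.ofReal β * klAvg ν pol piRef : ℝ≥0∞) : EReal)

/-- The concentrability `C^π = ∑ₓ ν₀(x) ∑ₐ π(a|x) · π(a|x) / π_data(a|x)`, possibly `∞`. -/
def conc (ν : PMF X) (piData pol : X → PMF A) : ℝ≥0∞ :=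
  ∑' x, ν x * ∑' a, pol x a * (pol x a / piData x a)

/-- `C^max = max_{π ∈ Π} C^π`. -/
def concMax (ν : PMF X) (piData : X → PMF A) (Pol : Finset (X → PMF A)) : ℝ≥0∞ :=
  Pol.sup (conc ν piData)

/-- `Err_π(r) = E_{x ∼ ν₀; a, b ∼ π(·|x)} (Δ_{r⋆}(x,a,b) - Δ_r(x,a,b))²`. -/
def err [MeasurableSpace X] [MeasurableSpace A]
    (ν : PMF X) (pol : X → PMF A) (rStar r : X → A → ℝ) : ℝ :=
  ∫ p, (gap rStar p.1 p.2.1 p.2.2 - gap r p.1 p.2.1 p.2.2) ^ 2 ∂(pairLaw ν pol).toMeasure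

/-! ### Error levels and hyperparameters -/

/-- `Err_DPO(N, δ) = c R_max² exp(4 R_max) log(|Π|/δ) / N`. -/
def errDPO (c Rmax : ℝ) (cardPol : ℕ) (δ : ℝ) (N : ℕ) : ℝ :=
  c * Rmax ^ 2 * Real.exp (4 * Rmax) * Real.log (cardPol / δ) / N

/-- `(R_max + √(V log(2N/δ)))²`. -/
def ratScale (Rmax V δ : ℝ) (N : ℕ) : ℝ :=
  (Rmax + √(V * Real.log (2 * N / δ))) ^ 2

/-- `Err^max(r̂_rat) = c (R_max + √(V log(2N/δ)))² log(|R|/δ) / N`. -/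
def errRat (c Rmax V : ℝ) (cardRew : ℕ) (δ : ℝ) (N : ℕ) : ℝ :=
  c * ratScale Rmax V δ N * Real.log (cardRew / δ) / N

/-- `α = (1 + M / D)⁻¹` for the ranking error level `D` and the rating error level `M`. -/
def alpha (D M : ℝ) : ℝ := (1 + M / D)⁻¹

/-- `β₁ = (1 - α) / α · β`. -/
def beta1 (β D M : ℝ) : ℝ := (1 - alpha D M) / alpha D M * β

/-- The effective regularization `β β₁ / (β + β₁)`. -/
def betaEff (β D M : ℝ) : ℝ := β * beta1 β D M / (β + beta1 β D M)

/-- `γ = √(Err_max / (β² (1-α)² C⋆))` with `Err_max = 2 D M / (D + M)`. -/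
def gammaChi (β D M CStar : ℝ) : ℝ :=
  √((2 * D * M / (D + M)) / (β ^ 2 * (1 - alpha D M) ^ 2 * CStar))

/-- The explicit rate
`S B log(|R| (|R| + n) / δ) / (S N_rat + B N_rank)` with `S = R_max² exp(4 R_max)` and
`B = (R_max + √(V log(2 N_rat/δ)))²`. -/
def explicitRate (Rmax V δ : ℝ) (Nrank Nrat cardRew n : ℕ) : ℝ :=
  Rmax ^ 2 * Real.exp (4 * Rmax) * ratScale Rmax V δ Nrat
      * Real.log ((cardRew : ℝ) * (cardRew + n) / δ)
    / (Rmax ^ 2 * Real.exp (4 * Rmax) * Nrat + ratScale Rmax V δ Nrat * Nrank)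

/-! ### The algorithm -/

/-- `r̂` minimizes the least squares rating loss over the reward class `R`, where the data are
the tuples `((x', ã, ā), rating gap)`. -/
def IsLeastSquares (Rew : Finset (X → A → ℝ)) {N : ℕ} (data : Fin N → (X × A × A) × ℝ)
    (rHat : X → A → ℝ) : Prop :=
  rHat ∈ Rew ∧ ∀ r ∈ Rew,
    ∑ j, (gap rHat (data j).1.1 (data j).1.2.1 (data j).1.2.2 - (data j).2) ^ 2 ≤
    ∑ j, (gap r (data j).1.1 (data j).1.2.1 (data j).1.2.2 - (data j).2) ^ 2

open Classical in
/-- The restricted class `Π'`: the policies in `Π` with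
`|β Δ_{φ(π/π_ref)} - (β/β₁) Δ_{r̂}| ≤ R_max - R_min` everywhere. A policy which vanishes somewhere
is not a member, because `φ(0) = -∞`. -/
def restricted (γ β β₁ Rmin Rmax : ℝ) (piRef : X → PMF A) (rHat : X → A → ℝ)
    (Pol : Finset (X → PMF A)) : Finset (X → PMF A) :=
  Pol.filter fun pol => (∀ x a, pol x a ≠ 0) ∧
    ∀ x a b, |β * gap (phiRatio γ piRef pol) x a b - β / β₁ * gap rHat x a b| ≤ Rmax - Rmin

/-- `π_out` maximizes the log-likelihood
`∑ᵢ log σ(β Δ_{φ(π/π_ref)}(xᵢ,aᵢ⁺,aᵢ⁻) - (β/β₁) Δ_{r̂}(xᵢ,aᵢ⁺,aᵢ⁻))` over the class `Π'`. -/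
def IsRDPOOutput (γ β β₁ : ℝ) (piRef : X → PMF A) (rHat : X → A → ℝ)
    (Pol' : Finset (X → PMF A)) {N : ℕ} (data : Fin N → X × A × A) (pOut : X → PMF A) : Prop :=
  IsMaxOn (fun pol : X → PMF A => ∑ i, Real.log (Real.sigmoid
      (β * gap (phiRatio γ piRef pol) (data i).1 (data i).2.1 (data i).2.2
        - β / β₁ * gap rHat (data i).1 (data i).2.1 (data i).2.2))) Pol' pOut ∧ pOut ∈ Pol'

/-- `π` is the closed form solution `π = π_ref · φ⁻¹((r + ζ)/β)` of the regularized problem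
`max_π ⟨π, r⟩ - β γ D_χ²(π, π_ref) - β D_KL(π, π_ref)`, where `ζ(x)` is the normalization. For
`γ = 0` this reads `π(a|x) = π_ref(a|x) exp(r(x,a)/β) / Z(x)`. -/
def IsClosedForm (γ β : ℝ) (piRef : X → PMF A) (r : X → A → ℝ) (pol : X → PMF A) : Prop :=
  ∃ ζ : X → ℝ, ∀ x a, pol x a ≠ 0 ∧ β * phiRatio γ piRef pol x a = r x a + ζ x

/-- Realizability: for each `r ∈ R`, the class `Π` contains the closed form solution of the
regularized problem with the mixed reward `(1-α) r⋆ + α r`. -/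
def Realizable (γ β α : ℝ) (piRef : X → PMF A) (rStar : X → A → ℝ)
    (Rew : Finset (X → A → ℝ)) (Pol : Finset (X → PMF A)) : Prop :=
  ∀ r ∈ Rew, ∃ pol ∈ Pol,
    IsClosedForm γ β piRef (fun x a => (1 - α) * rStar x a + α * r x a) pol

/-- The bounds on a suboptimality gap `s` with a concentrability coefficient `C`: the
harmonic-mean form, and the two explicit forms. -/
def SuboptBounds (K C D M Rmax V δ : ℝ) (Nrank Nrat cardRew cardPol cardPol' : ℕ) (s : EReal) :
    Prop :=
  s ≤ ((K * √(C * (D * M / (D + M))) : ℝ) : EReal) ∧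
  s ≤ ((K * √(C * explicitRate Rmax V δ Nrank Nrat cardRew cardPol) : ℝ) : EReal) ∧
  (cardPol ≤ cardRew * (cardRew + cardPol') →
    s ≤ ((K * √(C * explicitRate Rmax V δ Nrank Nrat cardRew cardPol') : ℝ) : EReal))

end

end RDPO

namespace RDPO

/-! ### Exponential moments -/

/-! A policy π enters the likelihood only through its residual reward h = β φ(π/π_ref) - (β/β₁) r̂.
The hyperparameters are such that β' φ(π/π_ref) = (1-α) h + α r̂ with α = D/(D+M). So the reward for
which π is optimal mixes two estimates of r⋆: h, of error at most D from the rankings, and r̂, of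
error at most M from the ratings. Convexity of the square bounds the error of the mixture by (1-α)D
+ αM = 2DM/(D+M) (`mixed_error_le`), whatever the dependence between the estimates.

Statistics: both estimators optimize an empirical criterion over a finite class, so it suffices to
bound the probability that a fixed bad candidate beats r⋆. `rank_likelihood_le` does this with the
square root of the likelihood ratio (Bhattacharyya coefficient), `rating_loss_le` with a subgaussian
exponential moment. The ranking union bound runs over all pairs in R × Π, so r̂ may depend on the
ranking data. Realizability puts into Π', for each r, a policy whose residual is r⋆ up to prompt
shifts; it also gives |R| ≤ |Π|, so log(|Π|/δ) pays for the pairs.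

Regret: φ is the derivative of the convex function klFun(t) + γt²/2, so the tangent inequality makes
π_out optimal for its own induced reward (`integral_phiRatio_sub_le`). What remains is the mean of
r⋆ - β'φ under π⋆ and under π_out, and a change of measure costs √(C^π · Err) for each. If γ = 0,
both coefficients are at most C^max. If π_data = π_ref and γ > 0, the regularizer leaves a term -β'γ
C^{π_out}/2, which absorbs √(C^{π_out} · Err) by AM-GM, so that only C⋆ survives
(`sqrt_add_sqrt_add_le`). -/

lemma exp_le_add_exp_sq (x : ℝ) : Real.exp x ≤ x + Real.exp (x ^ 2) := by
  have h1 := Real.add_one_le_exp (x ^ 2)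
  -- The Taylor remainder is at most x² for |x| ≤ 1; outside, a crude comparison suffices. The
  -- linear term is kept because it has mean zero when x is a centered variable.
  rcases le_or_gt |x| 1 with h | h
  · have := (abs_le.1 (Real.abs_exp_sub_one_sub_id_le h)).2
    linarith
  · rcases lt_abs.1 h with h | h
    · have : Real.exp x ≤ Real.exp (x ^ 2) := Real.exp_le_exp.2 (by nlinarith)
      linarith
    · have : Real.exp x ≤ 1 := Real.exp_le_one_iff.2 (by linarith)
      nlinarith

/-- Layer cake bound for the exponential moment of a nonnegative variable with an
exponential tail. -/
lemma lintegral_exp_le_of_tail {Ω : Type*} [MeasurableSpace Ω] {P : Measure Ω}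
    [IsProbabilityMeasure P] {f : Ω → ℝ} (hf : Measurable f) (hf0 : ∀ y, 0 ≤ f y) {a b : ℝ}
    (ha : 0 < a) (hab : 2 * a ≤ b)
    (htail : ∀ t : ℝ, 0 ≤ t → P {y | t ≤ f y} ≤ ENNReal.ofReal (2 * Real.exp (-(b * t)))) :
    ∫⁻ y, ENNReal.ofReal (Real.exp (a * f y)) ∂P ≤ ENNReal.ofReal (1 + 4 * a / b) := by
  have hb : 0 < b := by linarith
  have hint : ∀ t : ℝ, ∫ u in (0 : ℝ)..t, a * Real.exp (a * u) = Real.exp (a * t) - 1 := by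
    intro t
    rw [intervalIntegral.integral_eq_sub_of_hasDerivAt (f := fun u => Real.exp (a * u))]
    · simp
    · intro x _
      have := ((hasDerivAt_id x).const_mul a).exp
      simpa [mul_comm] using this
    · exact (by fun_prop : Continuous fun u : ℝ => a * Real.exp (a * u)).intervalIntegrable _ _
  have key := lintegral_comp_eq_lintegral_meas_le_mul P (f := f)
    (g := fun u => a * Real.exp (a * u)) (Filter.Eventually.of_forall hf0) hf.aemeasurable
    (fun t _ => (by fun_prop : Continuous fun u : ℝ => a * Real.exp (a * u)).intervalIntegrable _ _)
    (Filter.Eventually.of_forall fun t => by positivity)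
  simp only [hint] at key
  have hneg : a - b < 0 := by linarith
  -- The tail integrates to 2a/(b-a), which is at most 4a/b because 2a ≤ b.
  have hbound : ∫⁻ t in Set.Ioi (0 : ℝ), P {y | t ≤ f y} * ENNReal.ofReal (a * Real.exp (a * t))
      ≤ ENNReal.ofReal (4 * a / b) := by
    calc _ ≤ ∫⁻ t in Set.Ioi (0 : ℝ), ENNReal.ofReal (2 * a * Real.exp ((a - b) * t)) := by
          refine setLIntegral_mono (by fun_prop) fun t ht => ?_
          refine (mul_le_mul_left (htail t (le_of_lt ht)) _).trans_eq ?_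
          rw [← ENNReal.ofReal_mul (by positivity)]
          congr 1
          rw [show (a - b) * t = -(b * t) + a * t by ring, Real.exp_add]
          ring
      _ = ENNReal.ofReal (∫ t in Set.Ioi (0 : ℝ), 2 * a * Real.exp ((a - b) * t)) := by
          rw [ofReal_integral_eq_lintegral_ofReal]
          · exact (integrableOn_exp_mul_Ioi hneg 0).const_mul _
          · exact Filter.Eventually.of_forall fun t => by positivity
      _ ≤ _ := by
          rw [integral_const_mul, integral_exp_mul_Ioi hneg]
          refine ENNReal.ofReal_le_ofReal ?_
          rw [mul_zero, Real.exp_zero, neg_div, ← div_neg, neg_sub, mul_one_div,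
            div_le_div_iff₀ (by linarith) hb]
          nlinarith
  calc ∫⁻ y, ENNReal.ofReal (Real.exp (a * f y)) ∂P
      = ∫⁻ y, (1 + ENNReal.ofReal (Real.exp (a * f y) - 1)) ∂P := by
        refine lintegral_congr fun y => ?_
        rw [← ENNReal.ofReal_one, ← ENNReal.ofReal_add zero_le_one]
        · congr 1; ring
        · have := Real.one_le_exp (mul_nonneg ha.le (hf0 y))
          linarith
    _ = 1 + ∫⁻ y, ENNReal.ofReal (Real.exp (a * f y) - 1) ∂P := by
        rw [lintegral_add_left measurable_const]
        simp
    _ ≤ 1 + ENNReal.ofReal (4 * a / b) := by rw [key]; gcongr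
    _ = _ := by
        rw [ENNReal.ofReal_add zero_le_one (by positivity), ENNReal.ofReal_one]

/-- Centered subgaussian laws have a subgaussian exponential moment. -/
lemma IsUnbiasedSubgaussian.lintegral_exp_le {V m : ℝ} {P : Measure ℝ} [IsProbabilityMeasure P]
    (h : IsUnbiasedSubgaussian V m P) (hV : 0 < V) {s : ℝ} (hs : s ^ 2 ≤ 1 / (4 * V)) :
    ∫⁻ y, ENNReal.ofReal (Real.exp (s * (y - m))) ∂P ≤ ENNReal.ofReal (Real.exp (8 * V * s ^ 2)) := by
  rcases eq_or_ne s 0 with rfl | hs0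
  · simp
  have hs2 : 0 < s ^ 2 := by positivity
  -- The tail bound at √t says that (y-m)² has an exponential tail of rate b = 1/(2V). With a = s²,
  -- the hypothesis s² ≤ 1/(4V) is exactly 2a ≤ b.
  have hsq : ∫⁻ y, ENNReal.ofReal (Real.exp (s ^ 2 * (y - m) ^ 2)) ∂P
      ≤ ENNReal.ofReal (1 + 4 * s ^ 2 / (1 / (2 * V))) := by
    refine lintegral_exp_le_of_tail (f := fun y => (y - m) ^ 2) (by fun_prop)
      (fun y => sq_nonneg _) hs2 ?_ ?_
    · calc 2 * s ^ 2 ≤ 2 * (1 / (4 * V)) := by linarith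
        _ = 1 / (2 * V) := by field_simp; norm_num
    · intro t ht
      have := h.tail (√t) (Real.sqrt_nonneg t)
      rw [Real.sq_sqrt ht] at this
      convert! this using 3
      · ext y
        rw [← sq_abs]
        exact (Real.sqrt_le_left (abs_nonneg _)).symm
      · congr 1; field_simp
  have hint : Integrable (fun y => Real.exp (s ^ 2 * (y - m) ^ 2)) P := by
    refine (lintegral_ofReal_ne_top_iff_integrable (by fun_prop)
      (Filter.Eventually.of_forall fun y => (Real.exp_pos _).le)).1 ?_
    exact ne_top_of_le_ne_top ENNReal.ofReal_ne_top hsq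
  have hlin : Integrable (fun y => s * (y - m)) P :=
    (h.integrable.sub (integrable_const m)).const_mul s
  have hle : ∀ y, Real.exp (s * (y - m)) ≤ s * (y - m) + Real.exp (s ^ 2 * (y - m) ^ 2) := by
    intro y
    have := exp_le_add_exp_sq (s * (y - m))
    rwa [mul_pow] at this
  have hint0 : Integrable (fun y => Real.exp (s * (y - m))) P := by
    refine (hlin.add hint).mono' (by fun_prop) (Filter.Eventually.of_forall fun y => ?_)
    rw [Real.norm_eq_abs, abs_of_pos (Real.exp_pos _)]
    exact hle y
  rw [← ofReal_integral_eq_lintegral_ofReal hint0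
    (Filter.Eventually.of_forall fun y => (Real.exp_pos _).le)]
  refine ENNReal.ofReal_le_ofReal ?_
  rw [← ofReal_integral_eq_lintegral_ofReal hint
    (Filter.Eventually.of_forall fun y => (Real.exp_pos _).le),
    ENNReal.ofReal_le_ofReal_iff (by positivity)] at hsq
  have hmean : ∫ y, s * (y - m) ∂P = 0 := by
    rw [integral_const_mul, integral_sub h.integrable (integrable_const m), h.mean]
    simp
  calc ∫ y, Real.exp (s * (y - m)) ∂P
      ≤ ∫ y, (s * (y - m) + Real.exp (s ^ 2 * (y - m) ^ 2)) ∂P :=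
        integral_mono hint0 (hlin.add hint) hle
    _ = ∫ y, Real.exp (s ^ 2 * (y - m) ^ 2) ∂P := by
        rw [integral_add hlin hint, hmean, zero_add]
    _ ≤ 1 + 4 * s ^ 2 / (1 / (2 * V)) := hsq
    _ = 8 * V * s ^ 2 + 1 := by field_simp; ring
    _ ≤ _ := Real.add_one_le_exp _

/-- Chernoff bound for independent variables. -/
lemma measure_sum_nonneg_le {Ω : Type*} [MeasurableSpace Ω] {μ : Measure Ω} {N : ℕ}
    {Z : Fin N → Ω → ℝ} (hind : iIndepFun Z μ) (hm : ∀ i, AEMeasurable (Z i) μ) {a : ℝ}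
    (hZ : ∀ i, ∫⁻ ω, ENNReal.ofReal (Real.exp (Z i ω)) ∂μ ≤ ENNReal.ofReal (Real.exp (-a))) :
    μ {ω | 0 ≤ ∑ i, Z i ω} ≤ ENNReal.ofReal (Real.exp (-(N * a))) := by
  -- The variables are only a.e. measurable, so the product formula is applied to their measurable
  -- modifications.
  have hm' : ∀ i, AEMeasurable (fun ω => ENNReal.ofReal (Real.exp (Z i ω))) μ := fun i =>
    ((hm i).exp).ennreal_ofReal
  have hind' : iIndepFun (fun i => (hm' i).mk) μ :=
    (hind.comp (fun _ x => ENNReal.ofReal (Real.exp x)) (fun _ => by fun_prop)).congr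
      fun i => (hm' i).ae_eq_mk
  have hprod : ∫⁻ ω, ∏ i, ENNReal.ofReal (Real.exp (Z i ω)) ∂μ
      ≤ ENNReal.ofReal (Real.exp (-(N * a))) := by
    calc ∫⁻ ω, ∏ i, ENNReal.ofReal (Real.exp (Z i ω)) ∂μ
        = ∫⁻ ω, ∏ i, (hm' i).mk _ ω ∂μ := by
          refine lintegral_congr_ae ?_
          filter_upwards [ae_all_iff.2 fun i => (hm' i).ae_eq_mk] with ω hω
          exact Finset.prod_congr rfl fun i _ => hω i
      _ = ∏ i, ∫⁻ ω, ENNReal.ofReal (Real.exp (Z i ω)) ∂μ := by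
          rw [lintegral_prod_eq_prod_lintegral_of_indepFun _ _ hind' fun i =>
            (hm' i).measurable_mk]
          exact Finset.prod_congr rfl fun i _ => lintegral_congr_ae (hm' i).ae_eq_mk.symm
      _ ≤ ∏ _i : Fin N, ENNReal.ofReal (Real.exp (-a)) := Finset.prod_le_prod' fun i _ => hZ i
      _ = _ := by
          rw [Finset.prod_const, Finset.card_univ, Fintype.card_fin,
            ← ENNReal.ofReal_pow (Real.exp_pos _).le, ← Real.exp_nat_mul]
          congr 2; ring
  refine le_trans ?_ hprod
  have hmk := mul_meas_ge_le_lintegral₀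
    (Finset.aemeasurable_fun_prod Finset.univ fun i _ => hm' i) 1
  rw [one_mul] at hmk
  refine le_trans (measure_mono fun ω hω => ?_) hmk
  simp only [Set.mem_ofPred_eq] at hω ⊢
  rw [← ENNReal.ofReal_prod_of_nonneg fun i _ => (Real.exp_pos _).le, ← Real.exp_sum,
    ← ENNReal.ofReal_one]
  exact ENNReal.ofReal_le_ofReal (Real.one_le_exp hω)

/-! ### The Bradley-Terry likelihood -/

/-- The inverse of σ'(x) is (1 + eˣ)(1 + e⁻ˣ) ≤ 2 + 2e^R ≤ 4e^R. -/
lemma exp_neg_div_le_sigmoid_deriv {R x : ℝ} (hx : |x| ≤ R) :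
    Real.exp (-R) / 4 ≤ Real.sigmoid x * (1 - Real.sigmoid x) := by
  obtain ⟨h1, h2⟩ := abs_le.1 hx
  rw [← Real.sigmoid_neg, Real.sigmoid_def, Real.sigmoid_def, neg_neg, Real.exp_neg R,
    ← mul_inv, div_eq_mul_inv, ← mul_inv]
  refine inv_anti₀ (by positivity) ?_
  have e1 : Real.exp x ≤ Real.exp R := Real.exp_le_exp.2 h2
  have e2 : Real.exp (-x) ≤ Real.exp R := Real.exp_le_exp.2 (by linarith)
  have e3 : 1 ≤ Real.exp R := Real.one_le_exp (by linarith)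
  have e4 : Real.exp (-x) * Real.exp x = 1 := by rw [← Real.exp_add]; simp
  nlinarith

/-- Mean value theorem with σ' ≥ e^{-R}/4 on [-R, R]. This converts closeness of preference
probabilities into closeness of reward gaps. -/
lemma sigmoid_sub_sq_ge {R s t : ℝ} (hs : |s| ≤ R) (ht : |t| ≤ R) :
    Real.exp (-(2 * R)) / 16 * (t - s) ^ 2 ≤ (Real.sigmoid t - Real.sigmoid s) ^ 2 := by
  wlog hst : s < t generalizing s t
  · rcases eq_or_lt_of_le (not_lt.1 hst) with rfl | h
    · simp
    · have := this ht hs h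
      linarith [sq_nonneg (t - s), sub_sq_comm t s, sub_sq_comm (Real.sigmoid t) (Real.sigmoid s),
        congrArg (fun z => Real.exp (-(2 * R)) / 16 * z) (sub_sq_comm t s)]
  obtain ⟨c, hc, hc'⟩ := exists_hasDerivAt_eq_slope Real.sigmoid _ hst
    continuous_sigmoid.continuousOn fun x _ => Real.hasDerivAt_sigmoid x
  have hcR : |c| ≤ R := abs_le.2 ⟨by linarith [(abs_le.1 hs).1, hc.1], by
    linarith [(abs_le.1 ht).2, hc.2]⟩
  have hb := exp_neg_div_le_sigmoid_deriv hcR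
  rw [hc', le_div_iff₀ (sub_pos.2 hst)] at hb
  have hnn : 0 ≤ Real.exp (-R) / 4 * (t - s) :=
    mul_nonneg (by positivity) (sub_pos.2 hst).le
  calc _ = (Real.exp (-R) / 4 * (t - s)) ^ 2 := by
        rw [show -(2 * R) = -R + -R by ring, Real.exp_add]; ring
    _ ≤ _ := by gcongr

lemma mul_sqrt_div_self {p q : ℝ} (hp : 0 < p) (hq : 0 < q) : p * √(q / p) = √p * √q := by
  rw [Real.sqrt_div hq.le]
  have := Real.mul_self_sqrt hp.le
  have h0 : √p ≠ 0 := (Real.sqrt_pos.2 hp).ne'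
  field_simp
  nlinarith

/-- The Bhattacharyya coefficient of two Bradley-Terry laws. -/
lemma bhattacharyya_sigmoid_le {R s t : ℝ} (hs : |s| ≤ R) (ht : |t| ≤ R) :
    √(Real.sigmoid t) * √(Real.sigmoid s) + √(Real.sigmoid (-t)) * √(Real.sigmoid (-s))
      ≤ 1 - Real.exp (-(2 * R)) / 64 * (t - s) ^ 2 := by
  -- √p√q = (p+q)/2 - (√p-√q)²/2 and (p-q)² = (√p-√q)²(√p+√q)² ≤ 4(√p-√q)². Over the two outcomes
  -- the means add up to 1, and the two losses, each at least e^{-2R}(t-s)²/128, give the constant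
  -- 64.
  have key : ∀ p q : ℝ, 0 ≤ p → p ≤ 1 → 0 ≤ q → q ≤ 1 →
      √p * √q ≤ (p + q) / 2 - (p - q) ^ 2 / 8 := by
    intro p q hp hp1 hq hq1
    have h1 := Real.sq_sqrt hp
    have h2 := Real.sq_sqrt hq
    have h3 : √p ≤ 1 := Real.sqrt_le_one.2 hp1
    have h4 : √q ≤ 1 := Real.sqrt_le_one.2 hq1
    have h5 := Real.sqrt_nonneg p
    have h6 := Real.sqrt_nonneg q
    have h7 : (p - q) ^ 2 = (√p - √q) ^ 2 * (√p + √q) ^ 2 := by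
      rw [← mul_pow]; congr 1; linear_combination -h1 + h2
    have h8 : (√p + √q) ^ 2 ≤ 4 := by nlinarith
    have h9 := mul_le_mul_of_nonneg_left h8 (sq_nonneg (√p - √q))
    nlinarith
  have hsub := sigmoid_sub_sq_ge hs ht
  have k1 := key _ _ (Real.sigmoid_nonneg t) (Real.sigmoid_le_one t) (Real.sigmoid_nonneg s)
    (Real.sigmoid_le_one s)
  have k2 := key _ _ (Real.sigmoid_nonneg (-t)) (Real.sigmoid_le_one (-t))
    (Real.sigmoid_nonneg (-s)) (Real.sigmoid_le_one (-s))
  rw [Real.sigmoid_neg, Real.sigmoid_neg] at *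
  nlinarith

/-! ### Discrete laws -/

lemma pmf_lintegral {α : Type*} [MeasurableSpace α] [MeasurableSingletonClass α] [Countable α]
    (p : PMF α) (f : α → ℝ≥0∞) : ∫⁻ a, f a ∂p.toMeasure = ∑' a, p a * f a := by
  rw [lintegral_countable']
  refine tsum_congr fun a => ?_
  rw [PMF.toMeasure_apply_singleton p a (measurableSet_singleton a), mul_comm]

lemma pmf_lintegral_bind {α β : Type*} [MeasurableSpace α] [MeasurableSingletonClass α]
    [Countable α] [MeasurableSpace β] [MeasurableSingletonClass β] [Countable β]
    (p : PMF α) (q : α → PMF β) (f : β → ℝ≥0∞) :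
    ∫⁻ b, f b ∂(p.bind q).toMeasure = ∫⁻ a, ∫⁻ b, f b ∂(q a).toMeasure ∂p.toMeasure := by
  simp only [pmf_lintegral, PMF.bind_apply, ← ENNReal.tsum_mul_right, ← ENNReal.tsum_mul_left]
  rw [ENNReal.tsum_comm]
  simp only [mul_assoc]

lemma pmf_lintegral_map {α β : Type*} [MeasurableSpace α] [MeasurableSingletonClass α]
    [Countable α] [MeasurableSpace β] [MeasurableSingletonClass β] [Countable β]
    (p : PMF α) (g : α → β) (f : β → ℝ≥0∞) :
    ∫⁻ b, f b ∂(p.map g).toMeasure = ∫⁻ a, f (g a) ∂p.toMeasure := by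
  have hg : Measurable g := Measurable.of_discrete
  rw [← PMF.toMeasure_map g p hg, lintegral_map Measurable.of_discrete hg]

lemma integrable_of_abs_le {α : Type*} [MeasurableSpace α] [DiscreteMeasurableSpace α]
    {P : Measure α} [IsFiniteMeasure P] {f : α → ℝ} {C : ℝ} (h : ∀ a, |f a| ≤ C) :
    Integrable f P :=
  Integrable.of_bound Measurable.of_discrete.aestronglyMeasurable C
    (Filter.Eventually.of_forall h)

/-- An affine pointwise bound commutes with the expectation, so the exponent becomes the averaged
error; a pointwise bound e^{-f} would not allow this directly. -/
lemma lintegral_one_sub_le {α : Type*} [MeasurableSpace α] {P : Measure α}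
    [IsProbabilityMeasure P] {f : α → ℝ} (hf : Integrable f P) (h1 : ∀ a, f a ≤ 1) :
    ∫⁻ a, ENNReal.ofReal (1 - f a) ∂P ≤ ENNReal.ofReal (Real.exp (-∫ a, f a ∂P)) := by
  rw [← ofReal_integral_eq_lintegral_ofReal (f := fun a => 1 - f a) ((integrable_const 1).sub hf)
    (Filter.Eventually.of_forall fun a => sub_nonneg.2 (h1 a)),
    integral_sub (integrable_const 1) hf]
  refine ENNReal.ofReal_le_ofReal ?_
  simpa using Real.one_sub_le_exp_neg (∫ a, f a ∂P)

/-! ### Concentration of the likelihood and of the least squares loss -/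

section Concentration

variable {X : Type u} {A : Type v}

lemma gap_swap (r : X → A → ℝ) (x : X) (a b : A) : gap r x b a = -gap r x a b := by
  simp [gap]

variable [Countable X] [Countable A] [MeasurableSpace X] [MeasurableSingletonClass X]
  [MeasurableSpace A] [MeasurableSingletonClass A]

lemma rankLaw_lintegral (ν : PMF X) (piData : X → PMF A) (rStar : X → A → ℝ)
    (f : X × A × A → ℝ≥0∞) :
    ∫⁻ p, f p ∂(rankLaw ν piData rStar).toMeasure =
      ∫⁻ p, (ENNReal.ofReal (Real.sigmoid (gap rStar p.1 p.2.1 p.2.2)) * f p +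
        ENNReal.ofReal (Real.sigmoid (-gap rStar p.1 p.2.1 p.2.2)) * f (p.1, p.2.2, p.2.1))
        ∂(pairLaw ν piData).toMeasure := by
  rw [rankLaw, pmf_lintegral_bind]
  refine lintegral_congr fun p => ?_
  rw [pmf_lintegral_map, pmf_lintegral, tsum_bool]
  simp [preference, add_comm]

/-- A reward which is far from `r⋆` is unlikely to have the larger likelihood. -/
lemma rank_likelihood_le {Ω : Type w} [MeasurableSpace Ω] {μ : Measure Ω}
    (ν : PMF X) (piData : X → PMF A) {rStar h : X → A → ℝ} {R : ℝ} {N : ℕ}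
    {S : Fin N → Ω → X × A × A} (hS : iIndepFun S μ)
    (hlaw : ∀ i, HasLaw (S i) (rankLaw ν piData rStar).toMeasure μ)
    (hr : ∀ x a b, |gap rStar x a b| ≤ R) (hh : ∀ x a b, |gap h x a b| ≤ R) :
    μ {ω | ∑ i, Real.log (Real.sigmoid (gap rStar (S i ω).1 (S i ω).2.1 (S i ω).2.2)) ≤
        ∑ i, Real.log (Real.sigmoid (gap h (S i ω).1 (S i ω).2.1 (S i ω).2.2))} ≤
      ENNReal.ofReal (Real.exp (-(N * (Real.exp (-(2 * R)) / 64 * err ν piData rStar h)))) := by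
  -- The factor 1/2 makes e^Z the square root of the likelihood ratio, whose mean under the law of
  -- r⋆ is a Bhattacharyya coefficient.
  set Z : X × A × A → ℝ := fun p => (Real.log (Real.sigmoid (gap h p.1 p.2.1 p.2.2)) -
    Real.log (Real.sigmoid (gap rStar p.1 p.2.1 p.2.2))) / 2 with hZdef
  have hexp : ∀ p, Real.exp (Z p) = √(Real.sigmoid (gap h p.1 p.2.1 p.2.2) /
      Real.sigmoid (gap rStar p.1 p.2.1 p.2.2)) := by
    intro p
    simp only [hZdef]
    rw [← Real.log_div (Real.sigmoid_pos _).ne' (Real.sigmoid_pos _).ne', Real.exp_half,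
      Real.exp_log (div_pos (Real.sigmoid_pos _) (Real.sigmoid_pos _))]
  have hZm : Measurable Z := Measurable.of_discrete
  have hmain := measure_sum_nonneg_le (Z := fun i ω => Z (S i ω)) (N := N)
    (a := Real.exp (-(2 * R)) / 64 * err ν piData rStar h)
    (hS.comp (fun _ => Z) fun _ => hZm) (fun i => hZm.comp_aemeasurable (hlaw i).aemeasurable) ?_
  · refine le_trans (measure_mono fun ω hω => ?_) hmain
    simp only [Set.mem_ofPred_eq] at hω ⊢
    rw [hZdef, ← Finset.sum_div, Finset.sum_sub_distrib]
    linarith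
  · intro i
    rw [(hlaw i).lintegral_comp (f := fun p => ENNReal.ofReal (Real.exp (Z p)))
      Measurable.of_discrete.aemeasurable, rankLaw_lintegral]
    set f : X × A × A → ℝ := fun p => Real.exp (-(2 * R)) / 64 *
      (gap rStar p.1 p.2.1 p.2.2 - gap h p.1 p.2.1 p.2.2) ^ 2 with hf
    have hsq : ∀ p : X × A × A,
        (gap rStar p.1 p.2.1 p.2.2 - gap h p.1 p.2.1 p.2.2) ^ 2 ≤ (2 * R) ^ 2 := by
      intro p
      refine sq_le_sq' ?_ ?_ <;>
      linarith [abs_le.1 (hr p.1 p.2.1 p.2.2), abs_le.1 (hh p.1 p.2.1 p.2.2)]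
    have hpt : ∀ p : X × A × A,
        Real.sigmoid (gap rStar p.1 p.2.1 p.2.2) * Real.exp (Z p) +
          Real.sigmoid (-gap rStar p.1 p.2.1 p.2.2) * Real.exp (Z (p.1, p.2.2, p.2.1))
          ≤ 1 - f p := by
      intro p
      rw [hexp, hexp, gap_swap h p.1 p.2.1, gap_swap rStar p.1 p.2.1,
        mul_sqrt_div_self (Real.sigmoid_pos _) (Real.sigmoid_pos _),
        mul_sqrt_div_self (Real.sigmoid_pos _) (Real.sigmoid_pos _)]
      exact bhattacharyya_sigmoid_le (hh _ _ _) (hr _ _ _)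
    -- The left side of `hpt` is positive.
    have hf1 : ∀ p, f p ≤ 1 := by
      intro p
      have := hpt p
      have h1 := mul_pos (Real.sigmoid_pos (gap rStar p.1 p.2.1 p.2.2)) (Real.exp_pos (Z p))
      have h2 := mul_pos (Real.sigmoid_pos (-gap rStar p.1 p.2.1 p.2.2))
        (Real.exp_pos (Z (p.1, p.2.2, p.2.1)))
      linarith
    have hint : Integrable f (pairLaw ν piData).toMeasure := by
      refine (integrable_of_abs_le (C := (2 * R) ^ 2) fun p => ?_).const_mul _
      rw [abs_of_nonneg (sq_nonneg _)]
      exact hsq p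
    calc _ ≤ ∫⁻ p, ENNReal.ofReal (1 - f p) ∂(pairLaw ν piData).toMeasure := by
          refine lintegral_mono fun p => ?_
          simp only []
          rw [← ENNReal.ofReal_mul (Real.sigmoid_nonneg _),
            ← ENNReal.ofReal_mul (Real.sigmoid_nonneg _), ← ENNReal.ofReal_add]
          · exact ENNReal.ofReal_le_ofReal (hpt p)
          · exact mul_nonneg (Real.sigmoid_nonneg _) (Real.exp_pos _).le
          · exact mul_nonneg (Real.sigmoid_nonneg _) (Real.exp_pos _).le
      _ ≤ _ := lintegral_one_sub_le hint hf1
      _ = _ := by rw [hf, integral_const_mul, err]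

lemma exp_neg_le_one_sub_half {u : ℝ} (h0 : 0 ≤ u) (h1 : u ≤ 1) :
    Real.exp (-u) ≤ 1 - u / 2 := by
  have h := Real.add_one_le_exp u
  rw [Real.exp_neg]
  refine (inv_anti₀ (by linarith) h).trans ?_
  rw [inv_le_iff_one_le_mul₀ (by linarith)]
  nlinarith

/-- A reward which is far from `r⋆` is unlikely to have the smaller least squares loss. -/
lemma rating_loss_le {Ω : Type w} [MeasurableSpace Ω] {μ : Measure Ω}
    (ν : PMF X) (piData : X → PMF A) {rStar r : X → A → ℝ} {R V : ℝ} (hV : 0 < V)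
    {N : ℕ} {T : Fin N → Ω → (X × A × A) × ℝ} (hT : iIndepFun T μ)
    {κ : Fin N → Kernel (X × A × A) ℝ} [∀ j, IsMarkovKernel (κ j)]
    (hlaw : ∀ j, HasLaw (T j) ((pairLaw ν piData).toMeasure ⊗ₘ κ j) μ)
    (hsub : ∀ j x a b, IsUnbiasedSubgaussian V (gap rStar x a b) (κ j (x, a, b)))
    (hd : ∀ x a b, |gap rStar x a b - gap r x a b| ≤ 2 * R) :
    μ {ω | ∑ j, (gap r (T j ω).1.1 (T j ω).1.2.1 (T j ω).1.2.2 - (T j ω).2) ^ 2 ≤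
        ∑ j, (gap rStar (T j ω).1.1 (T j ω).1.2.1 (T j ω).1.2.2 - (T j ω).2) ^ 2} ≤
      ENNReal.ofReal (Real.exp (-(N * (1 / (256 * (V + R ^ 2)) * err ν piData rStar r)))) := by
  have hVR : 0 < V + R ^ 2 := by positivity
  -- The Chernoff parameter: both l·V and l·R² are at most 1/64, which controls the variance term
  -- and keeps l·d²/2 below 1.
  set l : ℝ := 1 / (64 * (V + R ^ 2)) with hl
  have hl0 : 0 < l := by positivity
  have hlV : l * V ≤ 1 / 64 := by
    rw [hl, div_mul_eq_mul_div, div_le_div_iff₀ (by positivity) (by norm_num)]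
    nlinarith [sq_nonneg R]
  have hlR : l * R ^ 2 ≤ 1 / 64 := by
    rw [hl, div_mul_eq_mul_div, div_le_div_iff₀ (by positivity) (by norm_num)]
    nlinarith [sq_nonneg R]
  set Z : (X × A × A) × ℝ → ℝ := fun z =>
    l * ((gap rStar z.1.1 z.1.2.1 z.1.2.2 - z.2) ^ 2 -
      (gap r z.1.1 z.1.2.1 z.1.2.2 - z.2) ^ 2) with hZdef
  have hgm : ∀ q : X → A → ℝ,
      Measurable fun z : (X × A × A) × ℝ => gap q z.1.1 z.1.2.1 z.1.2.2 := fun q =>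
    (Measurable.of_discrete (f := fun p : X × A × A => gap q p.1 p.2.1 p.2.2)).comp measurable_fst
  have hZm : Measurable Z :=
    ((((hgm rStar).sub measurable_snd).pow_const 2).sub
      (((hgm r).sub measurable_snd).pow_const 2)).const_mul l
  have hmain := measure_sum_nonneg_le (Z := fun i ω => Z (T i ω)) (N := N)
    (a := 1 / (256 * (V + R ^ 2)) * err ν piData rStar r)
    (hT.comp (fun _ => Z) fun _ => hZm) (fun i => hZm.comp_aemeasurable (hlaw i).aemeasurable) ?_
  · refine le_trans (measure_mono fun ω hω => ?_) hmain
    simp only [Set.mem_ofPred_eq] at hω ⊢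
    rw [hZdef, ← Finset.mul_sum, Finset.sum_sub_distrib]
    exact mul_nonneg hl0.le (sub_nonneg.2 hω)
  · intro j
    rw [(hlaw j).lintegral_comp (f := fun p => ENNReal.ofReal (Real.exp (Z p)))
      hZm.exp.ennreal_ofReal.aemeasurable,
      Measure.lintegral_compProd hZm.exp.ennreal_ofReal]
    set d : X × A × A → ℝ := fun p => gap rStar p.1 p.2.1 p.2.2 - gap r p.1 p.2.1 p.2.2 with hdd
    have hdsq : ∀ p, d p ^ 2 ≤ (2 * R) ^ 2 := fun p => by
      rw [← sq_abs]
      exact pow_le_pow_left₀ (abs_nonneg _) (hd _ _ _) 2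
    have hu1 : ∀ p, l * d p ^ 2 / 2 ≤ 1 := fun p => by
      have := mul_le_mul_of_nonneg_left (hdsq p) hl0.le
      nlinarith
    have hpt : ∀ p, ∫⁻ y, ENNReal.ofReal (Real.exp (Z (p, y))) ∂(κ j p) ≤
        ENNReal.ofReal (1 - l / 4 * d p ^ 2) := by
      intro p
      have hs : (-2 * l * d p) ^ 2 ≤ 1 / (4 * V) := by
        rw [le_div_iff₀ (by positivity)]
        have h1 := mul_le_mul_of_nonneg_left (hdsq p) (sq_nonneg l)
        have h2 := mul_le_mul hlV hlR (by positivity) (by norm_num)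
        have h3 := mul_le_mul_of_nonneg_left h1 hV.le
        nlinarith
      -- With noise ε = y - Δ_{r⋆}, the loss difference is -d² - 2dε. The noise contributes at most
      -- 8V(2ld)² = 32Vl²d² ≤ ld²/2 to the exponent, so half of the drift -ld² survives; passing to
      -- an affine bound halves it again.
      calc _ = ∫⁻ y, ENNReal.ofReal (Real.exp (-(l * d p ^ 2))) *
              ENNReal.ofReal (Real.exp (-2 * l * d p * (y - gap rStar p.1 p.2.1 p.2.2)))
              ∂(κ j p) := by
            refine lintegral_congr fun y => ?_
            rw [← ENNReal.ofReal_mul (Real.exp_pos _).le, ← Real.exp_add]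
            congr 2
            simp only [hZdef, hdd]
            ring
        _ ≤ ENNReal.ofReal (Real.exp (-(l * d p ^ 2))) *
              ENNReal.ofReal (Real.exp (8 * V * (-2 * l * d p) ^ 2)) := by
            rw [lintegral_const_mul _ (by fun_prop)]
            gcongr
            exact (hsub j p.1 p.2.1 p.2.2).lintegral_exp_le hV hs
        _ ≤ ENNReal.ofReal (Real.exp (-(l * d p ^ 2 / 2))) := by
            rw [← ENNReal.ofReal_mul (Real.exp_pos _).le, ← Real.exp_add]
            refine ENNReal.ofReal_le_ofReal (Real.exp_le_exp.2 ?_)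
            have := mul_le_mul_of_nonneg_right hlV (mul_nonneg hl0.le (sq_nonneg (d p)))
            nlinarith
        _ ≤ _ := by
            refine ENNReal.ofReal_le_ofReal
              ((exp_neg_le_one_sub_half (by positivity) (hu1 p)).trans_eq ?_)
            ring
    have hint : Integrable (fun p => l / 4 * d p ^ 2) (pairLaw ν piData).toMeasure := by
      refine (integrable_of_abs_le (C := (2 * R) ^ 2) fun p => ?_).const_mul _
      rw [abs_of_nonneg (sq_nonneg _)]
      exact hdsq p
    refine (lintegral_mono hpt).trans ((lintegral_one_sub_le hint fun p => ?_).trans_eq ?_)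
    · linarith [hu1 p, mul_nonneg hl0.le (sq_nonneg (d p))]
    · rw [integral_const_mul, err, hl, div_div]
      congr 5
      ring

end Concentration

/-! ### Densities of discrete laws -/

/-- Two laws of total mass 1 cannot be strictly ordered everywhere. This locates a response where a
policy ratio is at most 1 and, with the roles exchanged, one where it is at least 1. -/
lemma pmf_exists_le {α : Type*} (p q : PMF α) : ∃ a, p a ≤ q a := by
  by_contra! h
  obtain ⟨a, _⟩ := p.support_nonempty
  have := ENNReal.tsum_lt_tsum q.tsum_coe_ne_top (fun a => (h a).le) (h a)
  rw [PMF.tsum_coe, PMF.tsum_coe] at this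
  exact lt_irrefl _ this

section Density

variable {α : Type*} [MeasurableSpace α] [MeasurableSingletonClass α] [Countable α]

lemma pmf_toMeasure_eq_withDensity {P Q : PMF α} {s : α → ℝ}
    (h : ∀ a, (P a).toReal = s a * (Q a).toReal) (hs : ∀ a, 0 ≤ s a) :
    P.toMeasure = Q.toMeasure.withDensity fun a => ENNReal.ofReal (s a) := by
  refine Measure.ext_of_singleton fun a => ?_
  rw [withDensity_apply _ (measurableSet_singleton a), lintegral_singleton,
    PMF.toMeasure_apply_singleton _ _ (measurableSet_singleton a),
    PMF.toMeasure_apply_singleton _ _ (measurableSet_singleton a),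
    ← ENNReal.ofReal_toReal (P.apply_ne_top a), h a, ENNReal.ofReal_mul (hs a),
    ENNReal.ofReal_toReal (Q.apply_ne_top a)]

lemma pmf_integral_eq {P Q : PMF α} {s : α → ℝ}
    (h : ∀ a, (P a).toReal = s a * (Q a).toReal) (hs : ∀ a, 0 ≤ s a) (f : α → ℝ) :
    ∫ a, f a ∂P.toMeasure = ∫ a, s a * f a ∂Q.toMeasure := by
  rw [pmf_toMeasure_eq_withDensity h hs,
    integral_withDensity_eq_integral_toReal_smul Measurable.of_discrete
      (Filter.Eventually.of_forall fun a => ENNReal.ofReal_lt_top)]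
  simp [ENNReal.toReal_ofReal (hs _)]

/-- The integrand `klFun` is nonnegative, so the formula needs no integrability and covers infinite
divergence. -/
lemma pmf_klDiv_eq {P Q : PMF α} {s : α → ℝ}
    (h : ∀ a, (P a).toReal = s a * (Q a).toReal) (hs : ∀ a, 0 ≤ s a) :
    InformationTheory.klDiv P.toMeasure Q.toMeasure =
      ∫⁻ a, ENNReal.ofReal (InformationTheory.klFun (s a)) ∂Q.toMeasure := by
  have hd := pmf_toMeasure_eq_withDensity h hs
  rw [InformationTheory.klDiv_eq_lintegral_klFun_of_ac
    (by rw [hd]; exact withDensity_absolutelyContinuous _ _)]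
  refine lintegral_congr_ae ?_
  have := Measure.rnDeriv_withDensity Q.toMeasure
    (Measurable.of_discrete (f := fun a => ENNReal.ofReal (s a)))
  rw [← hd] at this
  filter_upwards [this] with a ha
  rw [ha, ENNReal.toReal_ofReal (hs a)]

lemma abs_integral_mul_le_sqrt {μ : Measure α} {f g : α → ℝ}
    (hf : Integrable (fun a => f a ^ 2) μ) (hg : Integrable (fun a => g a ^ 2) μ) :
    |∫ a, f a * g a ∂μ| ≤ √((∫ a, f a ^ 2 ∂μ) * ∫ a, g a ^ 2 ∂μ) := by
  have hf2 : MemLp f (ENNReal.ofReal 2) μ := by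
    rw [ENNReal.ofReal_ofNat]
    exact (memLp_two_iff_integrable_sq Measurable.of_discrete.aestronglyMeasurable).2 hf
  have hg2 : MemLp g (ENNReal.ofReal 2) μ := by
    rw [ENNReal.ofReal_ofNat]
    exact (memLp_two_iff_integrable_sq Measurable.of_discrete.aestronglyMeasurable).2 hg
  have h := integral_mul_norm_le_Lp_mul_Lq Real.HolderConjugate.two_two hf2 hg2
  simp only [Real.rpow_two, Real.norm_eq_abs, sq_abs, ← abs_mul, ← Real.sqrt_eq_rpow] at h
  rw [Real.sqrt_mul (integral_nonneg fun a => sq_nonneg _)]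
  exact abs_integral_le_integral_abs.trans h

end Density

/-! ### Joint laws of prompts and responses -/

section JointLaw

variable {X : Type u} {A : Type v}

/-- Law of `(x, a)` with `x ∼ ν` and `a ∼ π(·|x)`. -/
noncomputable def jointLaw (ν : PMF X) (pol : X → PMF A) : PMF (X × A) :=
  ν.bind fun x => (pol x).map fun a => (x, a)

/-- Law of `(x, a, b)` with `x ∼ ν` and `a ∼ π(·|x)`, `b ∼ ρ(·|x)` independent given `x`. -/
noncomputable def mixedPairLaw (ν : PMF X) (pol ρ : X → PMF A) : PMF (X × A × A) :=
  ν.bind fun x => (pol x).bind fun a => (ρ x).map fun b => (x, a, b)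

lemma mixedPairLaw_self (ν : PMF X) (pol : X → PMF A) :
    mixedPairLaw ν pol pol = pairLaw ν pol := rfl

lemma mixedPairLaw_map_left (ν : PMF X) (pol ρ : X → PMF A) :
    (mixedPairLaw ν pol ρ).map (fun p => (p.1, p.2.1)) = jointLaw ν pol := by
  simp only [mixedPairLaw, jointLaw, PMF.map_bind, PMF.map_comp, Function.comp_def]
  congr 1; ext1 x
  rw [← PMF.bind_pure_comp]
  congr 1; ext1 a
  exact PMF.map_const _ _

lemma mixedPairLaw_map_right (ν : PMF X) (pol ρ : X → PMF A) :
    (mixedPairLaw ν pol ρ).map (fun p => (p.1, p.2.2)) = jointLaw ν ρ := by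
  simp only [mixedPairLaw, jointLaw, PMF.map_bind, PMF.map_comp, Function.comp_def,
    PMF.bind_const]

lemma jointLaw_apply (ν : PMF X) (pol : X → PMF A) (p : X × A) :
    jointLaw ν pol p = ν p.1 * pol p.1 p.2 := by
  obtain ⟨x, a⟩ := p
  rw [jointLaw, PMF.bind_apply, tsum_eq_single x, PMF.map_apply, tsum_eq_single a]
  · simp
  · intro b hb; simp [hb.symm]
  · intro y hy
    simp [PMF.map_apply, hy.symm]

lemma mixedPairLaw_apply (ν : PMF X) (pol ρ : X → PMF A) (p : X × A × A) :
    mixedPairLaw ν pol ρ p = ν p.1 * (pol p.1 p.2.1 * ρ p.1 p.2.2) := by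
  obtain ⟨x, a, b⟩ := p
  rw [mixedPairLaw, PMF.bind_apply, tsum_eq_single x, PMF.bind_apply, tsum_eq_single a,
    PMF.map_apply, tsum_eq_single b]
  · simp
  · intro c hc; simp [hc.symm]
  · intro c hc; simp [PMF.map_apply, hc.symm]
  · intro y hy
    simp [PMF.map_apply, PMF.bind_apply, hy.symm]

/-- The density ratio `π(a|x) / ρ(a|x)`. -/
noncomputable def ratio (pol ρ : X → PMF A) (p : X × A) : ℝ :=
  (pol p.1 p.2).toReal / (ρ p.1 p.2).toReal

lemma ratio_nonneg (pol ρ : X → PMF A) (p : X × A) : 0 ≤ ratio pol ρ p := by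
  unfold ratio; positivity

/-- In `ℝ≥0∞` a positive number divided by 0 is `⊤`, so finite concentrability forces absolute
continuity at every prompt of positive mass. -/
lemma ne_zero_of_conc_ne_top {ν : PMF X} {ρ pol : X → PMF A} (h : conc ν ρ pol ≠ ⊤) {x : X}
    (hx : ν x ≠ 0) {a : A} (ha : ρ x a = 0) : pol x a = 0 := by
  by_contra hne
  refine h (ENNReal.tsum_eq_top_of_eq_top ⟨x, ?_⟩)
  refine (congrArg _ (ENNReal.tsum_eq_top_of_eq_top ⟨a, ?_⟩)).trans (ENNReal.mul_top hx)
  rw [ha, ENNReal.div_zero hne, ENNReal.mul_top hne]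

lemma jointLaw_eq_ratio_mul {ν : PMF X} {ρ pol : X → PMF A}
    (h : ∀ x, ν x ≠ 0 → ∀ a, ρ x a = 0 → pol x a = 0) (p : X × A) :
    (jointLaw ν pol p).toReal = ratio pol ρ p * (jointLaw ν ρ p).toReal := by
  rw [jointLaw_apply, jointLaw_apply, ENNReal.toReal_mul, ENNReal.toReal_mul, ratio]
  by_cases hx : ν p.1 = 0
  · simp [hx]
  by_cases ha : ρ p.1 p.2 = 0
  · simp [ha, h _ hx _ ha]
  · have : (ρ p.1 p.2).toReal ≠ 0 := ENNReal.toReal_ne_zero.2 ⟨ha, PMF.apply_ne_top _ _⟩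
    field_simp

variable [Countable X] [Countable A] [MeasurableSpace X] [MeasurableSingletonClass X]
  [MeasurableSpace A] [MeasurableSingletonClass A]

lemma jointLaw_lintegral (ν : PMF X) (pol : X → PMF A) (f : X × A → ℝ≥0∞) :
    ∫⁻ p, f p ∂(jointLaw ν pol).toMeasure =
      ∫⁻ x, ∫⁻ a, f (x, a) ∂(pol x).toMeasure ∂ν.toMeasure := by
  rw [jointLaw, pmf_lintegral_bind]
  simp only [pmf_lintegral_map]

lemma value_eq_integral {ν : PMF X} {pol : X → PMF A} {r : X → A → ℝ} {C : ℝ}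
    (hr : ∀ x a, |r x a| ≤ C) :
    value ν pol r = ∫ p, r p.1 p.2 ∂(jointLaw ν pol).toMeasure := by
  let κ : Kernel X A := ⟨fun x => (pol x).toMeasure, Measurable.of_discrete⟩
  have : IsMarkovKernel κ := ⟨fun x => inferInstanceAs (IsProbabilityMeasure (pol x).toMeasure)⟩
  have hκ : (jointLaw ν pol).toMeasure = ν.toMeasure ⊗ₘ κ := by
    ext s hs
    rw [← lintegral_indicator_one hs, jointLaw_lintegral, ← lintegral_indicator_one hs,
      Measure.lintegral_compProd (measurable_one.indicator hs)]
    rfl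
  rw [hκ, Measure.integral_compProd (integrable_of_abs_le (C := C) fun p => hr p.1 p.2)]
  rfl

/-- Where ρ vanishes the real ratio is 0 by convention; finiteness ensures that π vanishes there
too, so π²/ρ = ρ·(π/ρ)² holds throughout. -/
lemma conc_eq_lintegral {ν : PMF X} {ρ pol : X → PMF A} (h : conc ν ρ pol ≠ ⊤) :
    conc ν ρ pol = ∫⁻ p, ENNReal.ofReal (ratio pol ρ p ^ 2) ∂(jointLaw ν ρ).toMeasure := by
  rw [jointLaw_lintegral, pmf_lintegral]
  refine tsum_congr fun x => ?_
  by_cases hx : ν x = 0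
  · simp [hx]
  congr 1
  rw [pmf_lintegral]
  refine tsum_congr fun a => ?_
  by_cases ha : ρ x a = 0
  · simp [ha, ne_zero_of_conc_ne_top h hx ha]
  · have hq : 0 < (ρ x a).toReal := ENNReal.toReal_pos ha (PMF.apply_ne_top _ _)
    rw [← ENNReal.ofReal_toReal (PMF.apply_ne_top (pol x) a),
      ← ENNReal.ofReal_toReal (PMF.apply_ne_top (ρ x) a), ← ENNReal.ofReal_div_of_pos hq,
      ← ENNReal.ofReal_mul ENNReal.toReal_nonneg, ← ENNReal.ofReal_mul ENNReal.toReal_nonneg]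
    congr 1
    simp only [ratio]
    field_simp

lemma integrable_ratio_sq {ν : PMF X} {ρ pol : X → PMF A} (h : conc ν ρ pol ≠ ⊤) :
    Integrable (fun p => ratio pol ρ p ^ 2) (jointLaw ν ρ).toMeasure := by
  refine (lintegral_ofReal_ne_top_iff_integrable Measurable.of_discrete.aestronglyMeasurable
    (Filter.Eventually.of_forall fun p => sq_nonneg _)).1 ?_
  rwa [← conc_eq_lintegral h]

lemma conc_toReal {ν : PMF X} {ρ pol : X → PMF A} (h : conc ν ρ pol ≠ ⊤) :
    (conc ν ρ pol).toReal = ∫ p, ratio pol ρ p ^ 2 ∂(jointLaw ν ρ).toMeasure := by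
  rw [conc_eq_lintegral h, ← ofReal_integral_eq_lintegral_ofReal (integrable_ratio_sq h)
    (Filter.Eventually.of_forall fun p => sq_nonneg _),
    ENNReal.toReal_ofReal (integral_nonneg fun p => sq_nonneg _)]

lemma integral_mixedPairLaw_left (ν : PMF X) (pol ρ : X → PMF A) (f : X × A → ℝ) :
    ∫ p, f (p.1, p.2.1) ∂(mixedPairLaw ν pol ρ).toMeasure =
      ∫ p, f p ∂(jointLaw ν pol).toMeasure := by
  rw [← mixedPairLaw_map_left ν pol ρ, ← PMF.toMeasure_map _ _ Measurable.of_discrete,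
    integral_map Measurable.of_discrete.aemeasurable Measurable.of_discrete.aestronglyMeasurable]

lemma integral_mixedPairLaw_right (ν : PMF X) (pol ρ : X → PMF A) (f : X × A → ℝ) :
    ∫ p, f (p.1, p.2.2) ∂(mixedPairLaw ν pol ρ).toMeasure =
      ∫ p, f p ∂(jointLaw ν ρ).toMeasure := by
  rw [← mixedPairLaw_map_right ν pol ρ, ← PMF.toMeasure_map _ _ Measurable.of_discrete,
    integral_map Measurable.of_discrete.aemeasurable Measurable.of_discrete.aestronglyMeasurable]

/-- Change of measure: the mean of `u` under `π` and under `ρ` differ by at most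
`√(C^π E_ρ (Δ_u)²)`. -/
lemma abs_integral_sub_integral_le {ν : PMF X} {ρ pol : X → PMF A} (h : conc ν ρ pol ≠ ⊤)
    {w : X → A → ℝ} {C : ℝ} (hw : ∀ x a, |w x a| ≤ C) :
    |∫ p, w p.1 p.2 ∂(jointLaw ν pol).toMeasure - ∫ p, w p.1 p.2 ∂(jointLaw ν ρ).toMeasure| ≤
      √((conc ν ρ pol).toReal *
        ∫ p, gap w p.1 p.2.1 p.2.2 ^ 2 ∂(pairLaw ν ρ).toMeasure) := by
  have hac := fun x hx a => ne_zero_of_conc_ne_top h (x := x) hx (a := a)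
  -- Only the first response is reweighted. The second, drawn from ρ, serves as a baseline: the
  -- difference of means becomes the mean of a gap, so Cauchy-Schwarz involves only gaps of w.
  have hdens : ∀ p : X × A × A, (mixedPairLaw ν pol ρ p).toReal =
      ratio pol ρ (p.1, p.2.1) * (mixedPairLaw ν ρ ρ p).toReal := by
    intro p
    have := jointLaw_eq_ratio_mul hac (p.1, p.2.1)
    simp only [jointLaw_apply, mixedPairLaw_apply, ENNReal.toReal_mul] at this ⊢
    linear_combination (ρ p.1 p.2.2).toReal * this
  have hsq : Integrable (fun p : X × A × A => ratio pol ρ (p.1, p.2.1) ^ 2)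
      (pairLaw ν ρ).toMeasure := by
    have := integrable_ratio_sq h
    rw [← mixedPairLaw_map_left ν ρ ρ, ← PMF.toMeasure_map _ _ Measurable.of_discrete,
      integrable_map_measure Measurable.of_discrete.aestronglyMeasurable
        Measurable.of_discrete.aemeasurable] at this
    exact this
  have hgap : ∀ p : X × A × A, |gap w p.1 p.2.1 p.2.2 ^ 2| ≤ (2 * C) ^ 2 := by
    intro p
    rw [abs_pow]
    refine pow_le_pow_left₀ (abs_nonneg _) ?_ 2
    have := abs_sub (w p.1 p.2.1) (w p.1 p.2.2)
    rw [gap]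
    linarith [hw p.1 p.2.1, hw p.1 p.2.2]
  calc _ = |∫ p, gap w p.1 p.2.1 p.2.2 ∂(mixedPairLaw ν pol ρ).toMeasure| := by
        simp only [gap]
        rw [integral_sub (f := fun p : X × A × A => w p.1 p.2.1) (g := fun p : X × A × A => w p.1 p.2.2)
          (integrable_of_abs_le fun p => hw p.1 p.2.1)
          (integrable_of_abs_le fun p => hw p.1 p.2.2),
          integral_mixedPairLaw_left ν pol ρ fun p => w p.1 p.2,
          integral_mixedPairLaw_right ν pol ρ fun p => w p.1 p.2]
    _ = |∫ p, ratio pol ρ (p.1, p.2.1) * gap w p.1 p.2.1 p.2.2 ∂(pairLaw ν ρ).toMeasure| := by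
        rw [pmf_integral_eq hdens (fun p => ratio_nonneg _ _ _), mixedPairLaw_self]
    _ ≤ √((∫ p, ratio pol ρ (p.1, p.2.1) ^ 2 ∂(pairLaw ν ρ).toMeasure) *
        ∫ p, gap w p.1 p.2.1 p.2.2 ^ 2 ∂(pairLaw ν ρ).toMeasure) :=
        abs_integral_mul_le_sqrt hsq (integrable_of_abs_le hgap)
    _ = _ := by
        rw [← mixedPairLaw_self, integral_mixedPairLaw_left ν ρ ρ fun p => ratio pol ρ p ^ 2,
          ← conc_toReal h]

lemma klAvg_eq_lintegral {ν : PMF X} {pol piRef : X → PMF A} (href : ∀ x a, piRef x a ≠ 0) :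
    klAvg ν pol piRef = ∫⁻ p, ENNReal.ofReal (InformationTheory.klFun (ratio pol piRef p))
      ∂(jointLaw ν piRef).toMeasure := by
  rw [jointLaw_lintegral, pmf_lintegral]
  refine tsum_congr fun x => ?_
  rw [pmf_klDiv_eq (s := fun a => ratio pol piRef (x, a)) _ fun a => ratio_nonneg _ _ _]
  intro a
  have : (piRef x a).toReal ≠ 0 := ENNReal.toReal_ne_zero.2 ⟨href x a, PMF.apply_ne_top _ _⟩
  simp only [ratio]
  field_simp

lemma klAvg_spec {ν : PMF X} {pol piRef : X → PMF A} (href : ∀ x a, piRef x a ≠ 0)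
    (h : klAvg ν pol piRef ≠ ⊤) :
    Integrable (fun p => InformationTheory.klFun (ratio pol piRef p)) (jointLaw ν piRef).toMeasure ∧
    (klAvg ν pol piRef).toReal =
      ∫ p, InformationTheory.klFun (ratio pol piRef p) ∂(jointLaw ν piRef).toMeasure := by
  have hnn : ∀ p, 0 ≤ InformationTheory.klFun (ratio pol piRef p) := fun p =>
    InformationTheory.klFun_nonneg (ratio_nonneg _ _ _)
  have hint : Integrable (fun p => InformationTheory.klFun (ratio pol piRef p))
      (jointLaw ν piRef).toMeasure :=
    (lintegral_ofReal_ne_top_iff_integrable Measurable.of_discrete.aestronglyMeasurable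
      (Filter.Eventually.of_forall hnn)).1 (by rwa [← klAvg_eq_lintegral href])
  refine ⟨hint, ?_⟩
  rw [klAvg_eq_lintegral href, ← ofReal_integral_eq_lintegral_ofReal hint
    (Filter.Eventually.of_forall hnn), ENNReal.toReal_ofReal (integral_nonneg hnn)]

end JointLaw

/-! ### The regularized objective -/

lemma phi_mono {γ s t : ℝ} (hγ : 0 ≤ γ) (hs : 0 < s) (hst : s ≤ t) : phi γ s ≤ phi γ t := by
  unfold phi
  have := Real.log_le_log hs hst
  have := mul_le_mul_of_nonneg_left hst hγ
  linarith

/-- φ is the derivative of F(t) = klFun t + γt²/2, so this is the tangent inequality for the convex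
F. The quadratic part leaves γ(s-t)²/2, the entropy part t·klFun(s/t), both nonnegative. -/
lemma bregman_nonneg {γ s t : ℝ} (hγ : 0 ≤ γ) (hs : 0 ≤ s) (ht : 0 < t) :
    phi γ t * (s - t) ≤ InformationTheory.klFun s + γ / 2 * s ^ 2 -
      (InformationTheory.klFun t + γ / 2 * t ^ 2) := by
  have h1 : 0 ≤ γ / 2 * (s - t) ^ 2 := by positivity
  have h2 : Real.log t * (s - t) ≤ InformationTheory.klFun s - InformationTheory.klFun t := by
    simp only [InformationTheory.klFun_apply]
    rcases hs.eq_or_lt with rfl | hs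
    · simp; linarith
    · have h3 := mul_nonneg ht.le (InformationTheory.klFun_nonneg (div_pos hs ht).le)
      rw [InformationTheory.klFun_apply, Real.log_div hs.ne' ht.ne'] at h3
      have h4 : t * (s / t * (Real.log s - Real.log t) + 1 - s / t) =
          s * (Real.log s - Real.log t) + t - s := by field_simp
      rw [h4] at h3
      linarith
  unfold phi
  nlinarith

section Objective

variable {X : Type u} {A : Type v}

lemma phiRatio_eq (γ : ℝ) (piRef pol : X → PMF A) (x : X) (a : A) :
    phiRatio γ piRef pol x a = phi γ (ratio pol piRef (x, a)) := rfl

lemma ratio_pos {pol ρ : X → PMF A} {x : X} {a : A} (hp : pol x a ≠ 0) (hr : ρ x a ≠ 0) :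
    0 < ratio pol ρ (x, a) :=
  div_pos (ENNReal.toReal_pos hp (PMF.apply_ne_top _ _))
    (ENNReal.toReal_pos hr (PMF.apply_ne_top _ _))

/-- A bound on the gaps of the induced reward bounds the induced reward itself. -/
lemma abs_phiRatio_le {γ G : ℝ} (hγ : 0 ≤ γ) {piRef pol : X → PMF A}
    (href : ∀ x a, piRef x a ≠ 0) (hpos : ∀ x a, pol x a ≠ 0)
    (hG : ∀ x a b, |gap (phiRatio γ piRef pol) x a b| ≤ G) (x : X) (a : A) :
    |phiRatio γ piRef pol x a| ≤ γ + G := by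
  have hone : phi γ 1 = γ := by simp [phi]
  -- The normalization of the two policies pins the induced reward: it is at most φ(1) = γ at b and
  -- at least γ at c.
  obtain ⟨b, hb⟩ := pmf_exists_le (pol x) (piRef x)
  obtain ⟨c, hc⟩ := pmf_exists_le (piRef x) (pol x)
  have hb' : phiRatio γ piRef pol x b ≤ γ := by
    refine (phi_mono hγ (ratio_pos (hpos x b) (href x b)) ?_).trans_eq hone
    exact div_le_one_of_le₀ (ENNReal.toReal_mono (PMF.apply_ne_top _ _) hb) ENNReal.toReal_nonneg
  have hc' : γ ≤ phiRatio γ piRef pol x c := by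
    rw [phiRatio_eq]
    refine hone.symm.trans_le (phi_mono hγ one_pos ?_)
    exact (one_le_div (ENNReal.toReal_pos (href x c) (PMF.apply_ne_top _ _))).2
      (ENNReal.toReal_mono (PMF.apply_ne_top _ _) hc)
  have h1 := (abs_le.1 (hG x a b)).2
  have h2 := (abs_le.1 (hG x a c)).1
  simp only [gap] at h1 h2
  exact abs_le.2 ⟨by linarith, by linarith⟩

lemma ratio_le_exp {γ G : ℝ} (hγ : 0 ≤ γ) {piRef pol : X → PMF A} {x : X} {a : A}
    (href : piRef x a ≠ 0) (hpos : pol x a ≠ 0) (h : |phiRatio γ piRef pol x a| ≤ G) :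
    ratio pol piRef (x, a) ≤ Real.exp G := by
  have hr := ratio_pos hpos href
  rw [← Real.log_le_iff_le_exp hr]
  have := (abs_le.1 h).2
  rw [phiRatio_eq, phi] at this
  have := mul_nonneg hγ hr.le
  linarith

lemma klFun_le_sq_add_one {t : ℝ} (ht : 0 ≤ t) : InformationTheory.klFun t ≤ t ^ 2 + 1 := by
  rw [InformationTheory.klFun_apply]
  have h := mul_le_mul_of_nonneg_left (Real.log_le_self ht) ht
  nlinarith

lemma conc_ne_top {ν : PMF X} {pol piRef : X → PMF A} (href : ∀ x a, piRef x a ≠ 0) {L : ℝ}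
    (hL : ∀ p, ratio pol piRef p ≤ L) : conc ν piRef pol ≠ ⊤ := by
  have hle : ∀ x a, pol x a / piRef x a ≤ ENNReal.ofReal L := by
    intro x a
    rw [← ENNReal.ofReal_toReal (PMF.apply_ne_top (pol x) a),
      ← ENNReal.ofReal_toReal (PMF.apply_ne_top (piRef x) a),
      ← ENNReal.ofReal_div_of_pos (ENNReal.toReal_pos (href x a) (PMF.apply_ne_top _ _))]
    exact ENNReal.ofReal_le_ofReal (hL (x, a))
  refine ne_top_of_le_ne_top (b := ENNReal.ofReal L) ENNReal.ofReal_ne_top ?_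
  calc conc ν piRef pol ≤ ∑' x, ν x * ∑' a, pol x a * ENNReal.ofReal L := by
        refine ENNReal.tsum_le_tsum fun x => mul_le_mul_right (ENNReal.tsum_le_tsum fun a =>
          mul_le_mul_right (hle x a) _) _
    _ = _ := by simp [ENNReal.tsum_mul_right, PMF.tsum_coe]

variable [Countable X] [Countable A] [MeasurableSpace X] [MeasurableSingletonClass X]
  [MeasurableSpace A] [MeasurableSingletonClass A]

lemma klAvg_ne_top {ν : PMF X} {pol piRef : X → PMF A} (href : ∀ x a, piRef x a ≠ 0) {L : ℝ}
    (hL : ∀ p, ratio pol piRef p ≤ L) : klAvg ν pol piRef ≠ ⊤ := by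
  rw [klAvg_eq_lintegral href]
  refine ne_top_of_le_ne_top (b := ENNReal.ofReal (L ^ 2 + 1)) ENNReal.ofReal_ne_top ?_
  refine (lintegral_mono (g := fun _ => ENNReal.ofReal (L ^ 2 + 1)) fun p => ?_).trans_eq
    (by simp)
  refine ENNReal.ofReal_le_ofReal ((klFun_le_sq_add_one (ratio_nonneg _ _ _)).trans ?_)
  have := pow_le_pow_left₀ (ratio_nonneg pol piRef p) (hL p) 2
  linarith

/-- The policy which induces the reward `φ(π/π_ref)` is optimal for it among the policies, when
the regularizer is `γ/2 · E_ref (π/π_ref)² + KL`. -/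
lemma integral_phiRatio_sub_le {ν : PMF X} {piRef piData pStar pOut : X → PMF A}
    {γ G : ℝ} (hγ : 0 ≤ γ) (href : ∀ x a, piRef x a ≠ 0)
    (hpos : ∀ x a, pOut x a ≠ 0) (hG : ∀ x a, |phiRatio γ piRef pOut x a| ≤ G)
    (hkstar : klAvg ν pStar piRef ≠ ⊤) (hkout : klAvg ν pOut piRef ≠ ⊤)
    (hstar : conc ν piData pStar ≠ ⊤) (hout : conc ν piData pOut ≠ ⊤)
    (hγ' : γ = 0 ∨ piData = piRef) :
    ∫ p, phiRatio γ piRef pOut p.1 p.2 ∂(jointLaw ν pStar).toMeasure -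
      ∫ p, phiRatio γ piRef pOut p.1 p.2 ∂(jointLaw ν pOut).toMeasure ≤
      (klAvg ν pStar piRef).toReal + γ / 2 * (conc ν piData pStar).toReal -
      ((klAvg ν pOut piRef).toReal + γ / 2 * (conc ν piData pOut).toReal) := by
  have hac : ∀ (pol : X → PMF A) (p : X × A), (jointLaw ν pol p).toReal =
      ratio pol piRef p * (jointLaw ν piRef p).toReal := fun pol =>
    jointLaw_eq_ratio_mul fun x _ a ha => absurd ha (href x a)
  have hdens : ∀ pol : X → PMF A,
      ∫ p, phiRatio γ piRef pOut p.1 p.2 ∂(jointLaw ν pol).toMeasure =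
      ∫ p, ratio pol piRef p * phiRatio γ piRef pOut p.1 p.2 ∂(jointLaw ν piRef).toMeasure :=
    fun pol => pmf_integral_eq (hac pol) (fun p => ratio_nonneg _ _ _) _
  have hratio : ∀ pol : X → PMF A, Integrable (ratio pol piRef) (jointLaw ν piRef).toMeasure := by
    intro pol
    have h1 := pmf_toMeasure_eq_withDensity (hac pol) fun p => ratio_nonneg _ _ _
    have h2 : ∫⁻ p, ENNReal.ofReal (ratio pol piRef p) ∂(jointLaw ν piRef).toMeasure = 1 := by
      rw [← setLIntegral_univ, ← withDensity_apply _ MeasurableSet.univ, ← h1]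
      exact measure_univ
    exact (lintegral_ofReal_ne_top_iff_integrable Measurable.of_discrete.aestronglyMeasurable
      (Filter.Eventually.of_forall fun p => ratio_nonneg _ _ _)).1 (by rw [h2]; simp)
  have hfr : ∀ pol : X → PMF A,
      Integrable (fun p => ratio pol piRef p * phiRatio γ piRef pOut p.1 p.2)
        (jointLaw ν piRef).toMeasure := fun pol =>
    (hratio pol).mul_bdd (c := G) Measurable.of_discrete.aestronglyMeasurable
      (Filter.Eventually.of_forall fun p => hG p.1 p.2)
  have hreg : ∀ pol : X → PMF A, klAvg ν pol piRef ≠ ⊤ → conc ν piData pol ≠ ⊤ →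
      Integrable (fun p => InformationTheory.klFun (ratio pol piRef p) +
        γ / 2 * ratio pol piRef p ^ 2) (jointLaw ν piRef).toMeasure ∧
      (klAvg ν pol piRef).toReal + γ / 2 * (conc ν piData pol).toReal =
        ∫ p, (InformationTheory.klFun (ratio pol piRef p) +
          γ / 2 * ratio pol piRef p ^ 2) ∂(jointLaw ν piRef).toMeasure := by
    intro pol hk hc
    obtain ⟨hi, hk'⟩ := klAvg_spec href hk
    rcases hγ' with h0 | h0
    · subst h0
      simpa using ⟨hi, hk'⟩
    · subst h0
      have hs := (integrable_ratio_sq hc).const_mul (γ / 2)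
      exact ⟨hi.add hs, by rw [integral_add hi hs, integral_const_mul, conc_toReal hc, hk']⟩
  obtain ⟨hi1, he1⟩ := hreg _ hkstar hstar
  obtain ⟨hi2, he2⟩ := hreg _ hkout hout
  -- All four terms are now integrals against the reference law, and the inequality holds pointwise
  -- as a Bregman inequality at t = π_out/π_ref.
  rw [hdens, hdens, he1, he2, ← integral_sub (hfr _) (hfr _), ← integral_sub hi1 hi2]
  refine integral_mono ((hfr _).sub (hfr _)) (hi1.sub hi2) fun p => ?_
  have := bregman_nonneg hγ (ratio_nonneg pStar piRef p)
    (ratio_pos (hpos p.1 p.2) (href p.1 p.2))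
  rw [← phiRatio_eq] at this
  simp only []
  linarith

/-- The regret of the closed form optimizer of a surrogate reward. -/
lemma objective_sub_le {ν : PMF X} {piRef piData pStar pOut : X → PMF A} {rStar : X → A → ℝ}
    {γ b G C E : ℝ} (hγ : 0 ≤ γ) (hb : 0 < b) (href : ∀ x a, piRef x a ≠ 0)
    (hpos : ∀ x a, pOut x a ≠ 0) (hr : ∀ x a, |rStar x a| ≤ C)
    (hG : ∀ x a b, |gap (phiRatio γ piRef pOut) x a b| ≤ G)
    (hE : ∫ p, gap (fun x a => rStar x a - b * phiRatio γ piRef pOut x a) p.1 p.2.1 p.2.2 ^ 2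
      ∂(pairLaw ν piData).toMeasure ≤ E)
    (hstar : conc ν piData pStar ≠ ⊤) (hout : conc ν piData pOut ≠ ⊤)
    (hγ' : γ = 0 ∨ piData = piRef) :
    objective ν piRef b rStar pStar - objective ν piRef b rStar pOut ≤
      ((√((conc ν piData pStar).toReal * E) + √((conc ν piData pOut).toReal * E) +
        b * γ / 2 * ((conc ν piData pStar).toReal - (conc ν piData pOut).toReal) : ℝ) : EReal) := by
  obtain ⟨f, hf⟩ : ∃ f : X → A → ℝ, f = phiRatio γ piRef pOut := ⟨_, rfl⟩
  rw [← hf] at hG hE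
  have hfb : ∀ x a, |f x a| ≤ γ + G := hf ▸ abs_phiRatio_le hγ href hpos (hf ▸ hG)
  have hL : ∀ p, ratio pOut piRef p ≤ Real.exp (γ + G) := fun p =>
    ratio_le_exp hγ (href p.1 p.2) (hpos p.1 p.2) (hf ▸ hfb p.1 p.2)
  have hkout := klAvg_ne_top (ν := ν) href hL
  have hbt : ENNReal.ofReal b ≠ 0 := (ENNReal.ofReal_pos.2 hb).ne'
  -- A comparator of infinite divergence has objective -∞, so there is nothing to prove.
  by_cases hkstar : klAvg ν pStar piRef = ⊤
  · have : objective ν piRef b rStar pStar = ⊥ := by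
      rw [objective, hkstar, ENNReal.mul_top hbt, EReal.coe_ennreal_top, EReal.sub_top]
    rw [this, EReal.bot_sub]
    exact bot_le
  have hobj : ∀ pol : X → PMF A, klAvg ν pol piRef ≠ ⊤ → objective ν piRef b rStar pol =
      ((value ν pol rStar - b * (klAvg ν pol piRef).toReal : ℝ) : EReal) := by
    intro pol h
    have h2 : (ENNReal.ofReal b * klAvg ν pol piRef) = ENNReal.ofReal
        (b * (klAvg ν pol piRef).toReal) := by
      rw [ENNReal.ofReal_mul hb.le, ENNReal.ofReal_toReal h]
    rw [objective, h2, EReal.coe_ennreal_ofReal,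
      max_eq_left (mul_nonneg hb.le ENNReal.toReal_nonneg), EReal.coe_sub]
  rw [hobj _ hkstar, hobj _ hkout, ← EReal.coe_sub, EReal.coe_le_coe_iff]
  have hopt := integral_phiRatio_sub_le hγ href hpos (hf ▸ hfb) hkstar hkout hstar hout hγ'
  rw [← hf] at hopt
  -- r⋆ = w + bφ. The φ part is handled by optimality of π_out, the w part by changing measure
  -- twice; the mean of w under π_data cancels.
  obtain ⟨w, hw⟩ : ∃ w : X → A → ℝ, w = fun x a => rStar x a - b * f x a := ⟨_, rfl⟩
  rw [← hw] at hE
  have hwb : ∀ x a, |w x a| ≤ C + b * (γ + G) := by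
    intro x a
    rw [hw]
    refine (abs_sub _ _).trans (add_le_add (hr x a) ?_)
    rw [abs_mul, abs_of_pos hb]
    exact mul_le_mul_of_nonneg_left (hfb x a) hb.le
  have hchange : ∀ pol : X → PMF A, conc ν piData pol ≠ ⊤ →
      |∫ p, w p.1 p.2 ∂(jointLaw ν pol).toMeasure - ∫ p, w p.1 p.2 ∂(jointLaw ν piData).toMeasure|
        ≤ √((conc ν piData pol).toReal * E) := fun pol h =>
    (abs_integral_sub_integral_le h hwb).trans
      (Real.sqrt_le_sqrt (mul_le_mul_of_nonneg_left hE ENNReal.toReal_nonneg))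
  have hsplit : ∀ pol : X → PMF A, value ν pol rStar =
      ∫ p, w p.1 p.2 ∂(jointLaw ν pol).toMeasure +
        b * ∫ p, f p.1 p.2 ∂(jointLaw ν pol).toMeasure := by
    intro pol
    have hwi : Integrable (fun p : X × A => w p.1 p.2) (jointLaw ν pol).toMeasure :=
      integrable_of_abs_le fun p => hwb p.1 p.2
    have hfi : Integrable (fun p : X × A => b * f p.1 p.2) (jointLaw ν pol).toMeasure :=
      (integrable_of_abs_le (f := fun p : X × A => f p.1 p.2) fun p => hfb p.1 p.2).const_mul b
    rw [value_eq_integral hr, ← integral_const_mul, ← integral_add hwi hfi]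
    refine integral_congr_ae (Filter.Eventually.of_forall fun p => ?_)
    simp [hw]
  have h1 := (abs_le.1 (hchange _ hstar)).2
  have h2 := (abs_le.1 (hchange _ hout)).1
  have h3 := mul_le_mul_of_nonneg_left hopt hb.le
  rw [hsplit, hsplit]
  linarith

end Objective

/-! ### Union bounds -/

/-- Of the k+1 logarithms, k pay for the n^k events and the last leaves δ/n, which is at most δ/2
once n ≥ 2. If n < 2 there are no bad indices, so no separate log 2 is needed. -/
lemma measure_biUnion_le_half {Ω ι : Type*} [MeasurableSpace Ω] {μ : Measure Ω} {bad : Finset ι}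
    {s : ι → Set Ω} {n k : ℕ} {δ : ℝ} (hδ : 0 < δ) (hδ1 : δ < 1)
    (hcard : bad.card ≤ n ^ k) (hn : bad.Nonempty → 2 ≤ n)
    (h : ∀ i ∈ bad, μ (s i) ≤ ENNReal.ofReal (Real.exp (-((k + 1) * Real.log (n / δ))))) :
    μ (⋃ i ∈ bad, s i) ≤ ENNReal.ofReal (δ / 2) := by
  rcases bad.eq_empty_or_nonempty with rfl | hne
  · simp
  have hn2 := hn hne
  have hn0 : (0 : ℝ) < n := by positivity
  have hn2' : (2 : ℝ) ≤ n := by exact_mod_cast hn2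
  have hexp : Real.exp (-((k + 1) * Real.log (n / δ))) = (δ / n) ^ (k + 1) := by
    rw [← mul_neg, ← Real.log_inv, inv_div, mul_comm, ← Nat.cast_succ, Real.exp_mul,
      Real.exp_log (div_pos hδ hn0), Real.rpow_natCast]
  calc μ (⋃ i ∈ bad, s i) ≤ ∑ i ∈ bad, μ (s i) := measure_biUnion_finset_le _ _
    _ ≤ bad.card • ENNReal.ofReal ((δ / n) ^ (k + 1)) := by
        rw [← hexp]
        exact Finset.sum_le_card_nsmul _ _ _ h
    _ ≤ (n ^ k) • ENNReal.ofReal ((δ / n) ^ (k + 1)) := nsmul_le_nsmul_left zero_le hcard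
    _ = ENNReal.ofReal (n ^ k * (δ / n) ^ (k + 1)) := by
        rw [nsmul_eq_mul, ENNReal.ofReal_mul (by positivity), ← Nat.cast_pow,
          ENNReal.ofReal_natCast]
    _ ≤ _ := by
        refine ENNReal.ofReal_le_ofReal ?_
        have h1 : (n : ℝ) ^ k * (δ / n) ^ (k + 1) = δ ^ k * (δ / n) := by
          rw [pow_succ, ← mul_assoc, ← mul_pow, mul_div_cancel₀ _ hn0.ne']
        have h2 : δ ^ k ≤ 1 := pow_le_one₀ hδ.le hδ1.le
        have h3 : δ / n ≤ δ / 2 := div_le_div_of_nonneg_left hδ.le two_pos hn2'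
        rw [h1]
        calc δ ^ k * (δ / n) ≤ 1 * (δ / 2) := mul_le_mul h2 h3 (by positivity) zero_le_one
          _ = _ := one_mul _

/-- Only monotonicity and subadditivity are used, so neither event has to be measurable. -/
lemma one_sub_le_measure {Ω : Type*} [MeasurableSpace Ω] {μ : Measure Ω} [IsProbabilityMeasure μ]
    {good bad : Set Ω} {δ : ℝ} (hδ : 0 ≤ δ) (h : ∀ ω, ω ∉ bad → ω ∈ good)
    (hbad : μ bad ≤ ENNReal.ofReal δ) : ENNReal.ofReal (1 - δ) ≤ μ good := by
  rw [ENNReal.ofReal_sub _ hδ, ENNReal.ofReal_one, tsub_le_iff_right]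
  calc (1 : ℝ≥0∞) = μ Set.univ := measure_univ.symm
    _ ≤ μ (good ∪ bad) := measure_mono fun ω _ => by
        by_cases hω : ω ∈ bad
        · exact Or.inr hω
        · exact Or.inl (h ω hω)
    _ ≤ μ good + μ bad := measure_union_le _ _
    _ ≤ _ := by gcongr

/-! ### Error levels -/

lemma half_le_log_two_mul_div {N : ℕ} (hN : 0 < N) {δ : ℝ} (hδ : 0 < δ) (hδ1 : δ < 1) :
    1 / 2 ≤ Real.log (2 * N / δ) := by
  have hN' : (1 : ℝ) ≤ N := by exact_mod_cast hN
  have h1 : (2 : ℝ) ≤ 2 * N / δ := by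
    rw [le_div_iff₀ hδ]
    nlinarith
  have h2 := Real.log_le_log two_pos h1
  linarith [Real.log_two_gt_d9]

/-- Since log(2N/δ) ≥ 1/2, the scale B dominates the concentration constant V + R² of
`rating_loss_le`. -/
lemma add_sq_le_ratScale {R V δ : ℝ} (hR : 0 ≤ R) (hV : 0 < V) {N : ℕ} (hN : 0 < N)
    (hδ : 0 < δ) (hδ1 : δ < 1) : (V + R ^ 2) / 2 ≤ ratScale R V δ N := by
  have hL := half_le_log_two_mul_div hN hδ hδ1
  have h1 := mul_le_mul_of_nonneg_left hL hV.le
  have h2 : 0 ≤ V * Real.log (2 * N / δ) := by linarith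
  have h3 := Real.sq_sqrt h2
  have h4 := mul_nonneg hR (Real.sqrt_nonneg (V * Real.log (2 * N / δ)))
  rw [ratScale]
  nlinarith [sq_nonneg R]

lemma log_card_div_pos {n : ℕ} (hn : 0 < n) {δ : ℝ} (hδ : 0 < δ) (hδ1 : δ < 1) :
    0 < Real.log (n / δ) := by
  have hn' : (1 : ℝ) ≤ n := by exact_mod_cast hn
  exact Real.log_pos ((one_lt_div hδ).2 (by linarith))

lemma ratScale_pos {R V δ : ℝ} (hR : 0 ≤ R) (hV : 0 < V) {N : ℕ} (hN : 0 < N)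
    (hδ : 0 < δ) (hδ1 : δ < 1) : 0 < ratScale R V δ N :=
  lt_of_lt_of_le (by positivity) (add_sq_le_ratScale hR hV hN hδ hδ1)

lemma errDPO_pos {c R δ : ℝ} (hc : 0 < c) (hR : 0 < R) {n N : ℕ} (hn : 0 < n) (hN : 0 < N)
    (hδ : 0 < δ) (hδ1 : δ < 1) : 0 < errDPO c R n δ N := by
  have := log_card_div_pos hn hδ hδ1
  unfold errDPO
  positivity

lemma errRat_pos {c R V δ : ℝ} (hc : 0 < c) (hR : 0 ≤ R) (hV : 0 < V) {n N : ℕ} (hn : 0 < n)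
    (hN : 0 < N) (hδ : 0 < δ) (hδ1 : δ < 1) : 0 < errRat c R V n δ N := by
  have := log_card_div_pos hn hδ hδ1
  have := ratScale_pos hR hV hN hδ hδ1
  unfold errRat
  positivity

/-- DM/(D+M) increases in both arguments. Replacing both constants by their maximum and both
logarithms by the common larger one turns it into the explicit rate exactly. -/
lemma harmonic_le_explicitRate {c₁ c₂ R V δ : ℝ} (hc₁ : 0 < c₁) (hc₂ : 0 < c₂) (hR : 0 < R)
    (hV : 0 < V) (hδ : 0 < δ) (hδ1 : δ < 1) {Nrank Nrat cardRew cardPol n : ℕ}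
    (hNrank : 0 < Nrank) (hNrat : 0 < Nrat) (hRew : 0 < cardRew) (hPol : 0 < cardPol)
    (hn : cardPol ≤ cardRew * (cardRew + n)) :
    errDPO c₁ R cardPol δ Nrank * errRat c₂ R V cardRew δ Nrat /
      (errDPO c₁ R cardPol δ Nrank + errRat c₂ R V cardRew δ Nrat) ≤
      max c₁ c₂ * explicitRate R V δ Nrank Nrat cardRew n := by
  have hD := errDPO_pos hc₁ hR hPol hNrank hδ hδ1
  have hM := errRat_pos hc₂ hR.le hV hRew hNrat hδ hδ1
  have hB := ratScale_pos hR.le hV hNrat hδ hδ1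
  have hLP := log_card_div_pos hPol hδ hδ1
  have hLR := log_card_div_pos hRew hδ hδ1
  have hRew' : (0 : ℝ) < cardRew := by exact_mod_cast hRew
  have hPol' : (0 : ℝ) < cardPol := by exact_mod_cast hPol
  have hNrank' : (0 : ℝ) < Nrank := by exact_mod_cast hNrank
  have hNrat' : (0 : ℝ) < Nrat := by exact_mod_cast hNrat
  have hn' : (cardPol : ℝ) ≤ cardRew * (cardRew + n) := by exact_mod_cast hn
  have hr' : (cardRew : ℝ) ≤ cardRew * (cardRew + n) := by
    exact_mod_cast Nat.le_mul_of_pos_right cardRew (by omega : 0 < cardRew + n)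
  set L := Real.log ((cardRew : ℝ) * (cardRew + n) / δ) with hL
  have hPL : Real.log (cardPol / δ) ≤ L := by
    apply Real.log_le_log (by positivity); gcongr
  have hRL : Real.log (cardRew / δ) ≤ L := by
    apply Real.log_le_log (by positivity); gcongr
  have hL0 : 0 < L := hLR.trans_le hRL
  have hm1 := le_max_left c₁ c₂
  have hm2 := le_max_right c₁ c₂
  set m := max c₁ c₂
  have hm0 : 0 < m := hc₁.trans_le hm1
  set s := R ^ 2 * Real.exp (4 * R) with hs
  have hs0 : 0 < s := by positivity
  set B := ratScale R V δ Nrat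
  have hD' : errDPO c₁ R cardPol δ Nrank ≤ m * s * L / Nrank := by
    rw [errDPO, mul_assoc c₁, ← hs]
    gcongr
  have hM' : errRat c₂ R V cardRew δ Nrat ≤ m * B * L / Nrat := by
    rw [errRat]
    gcongr
  set D := errDPO c₁ R cardPol δ Nrank
  set M := errRat c₂ R V cardRew δ Nrat
  have hmono : ∀ {D M D' M' : ℝ}, 0 < D → 0 < M → D ≤ D' → M ≤ M' →
      D * M / (D + M) ≤ D' * M' / (D' + M') := by
    intro D M D' M' hD hM hDD hMM
    have hD0 := hD.trans_le hDD
    have hM0 := hM.trans_le hMM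
    rw [div_le_div_iff₀ (by positivity) (by positivity)]
    have e1 := mul_le_mul_of_nonneg_left hMM (mul_nonneg hD.le hD0.le)
    have e2 := mul_le_mul_of_nonneg_left hDD (mul_nonneg hM.le hM0.le)
    nlinarith
  refine (hmono hD hM hD' hM').trans_eq ?_
  rw [explicitRate, ← hs, ← hL]
  change _ = m * (s * B * L / (s * Nrat + B * Nrank))
  field_simp

lemma suboptBounds_of_le {c₁ c₂ R V δ C : ℝ} (hc₁ : 0 < c₁) (hc₂ : 0 < c₂) (hR : 0 < R)
    (hV : 0 < V) (hδ : 0 < δ) (hδ1 : δ < 1) (hC : 0 ≤ C)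
    {Nrank Nrat cardRew cardPol cardPol' : ℕ}
    (hNrank : 0 < Nrank) (hNrat : 0 < Nrat) (hRew : 0 < cardRew) (hPol : 0 < cardPol)
    {s : EReal} {D M : ℝ} (hD : D = errDPO c₁ R cardPol δ Nrank)
    (hM : M = errRat c₂ R V cardRew δ Nrat)
    (h : s ≤ ((2 * √(C * (2 * D * M / (D + M))) : ℝ) : EReal)) :
    SuboptBounds (4 * (1 + √(max c₁ c₂))) C D M R V δ Nrank Nrat cardRew cardPol cardPol' s := by
  have hm : 0 < max c₁ c₂ := lt_max_of_lt_left hc₁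
  have h1 : 2 * √(C * (2 * D * M / (D + M))) ≤ 4 * √(C * (D * M / (D + M))) := by
    have : C * (2 * D * M / (D + M)) = 2 * (C * (D * M / (D + M))) := by ring
    rw [this, Real.sqrt_mul zero_le_two]
    have h2 : √2 ≤ 2 := (Real.sqrt_le_left zero_le_two).2 (by norm_num)
    nlinarith [Real.sqrt_nonneg (C * (D * M / (D + M)))]
  have hs : s ≤ ((4 * √(C * (D * M / (D + M))) : ℝ) : EReal) :=
    h.trans (EReal.coe_le_coe_iff.2 h1)
  have hrate : ∀ n, cardPol ≤ cardRew * (cardRew + n) →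
      s ≤ ((4 * (1 + √(max c₁ c₂)) *
        √(C * explicitRate R V δ Nrank Nrat cardRew n) : ℝ) : EReal) := by
    intro n hn
    refine hs.trans (EReal.coe_le_coe_iff.2 ?_)
    have h3 := harmonic_le_explicitRate hc₁ hc₂ hR hV hδ hδ1 hNrank hNrat hRew hPol hn
    rw [← hD, ← hM] at h3
    have h4 : √(C * (D * M / (D + M))) ≤
        √(max c₁ c₂) * √(C * explicitRate R V δ Nrank Nrat cardRew n) := by
      rw [← Real.sqrt_mul hm.le]
      refine Real.sqrt_le_sqrt ((mul_le_mul_of_nonneg_left h3 hC).trans_eq ?_)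
      ring
    have h5 := Real.sqrt_nonneg (C * explicitRate R V δ Nrank Nrat cardRew n)
    nlinarith
  refine ⟨hs.trans (EReal.coe_le_coe_iff.2 ?_), hrate _ ?_, hrate _⟩
  · have h5 := Real.sqrt_nonneg (C * (D * M / (D + M)))
    have h6 := Real.sqrt_nonneg (max c₁ c₂)
    nlinarith [mul_nonneg h5 h6]
  · exact (Nat.le_add_left _ _).trans (Nat.le_mul_of_pos_left _ hRew)

lemma alpha_eq {D M : ℝ} (hD : 0 < D) (hM : 0 < M) : alpha D M = D / (D + M) := by
  unfold alpha; field_simp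

lemma one_sub_alpha_eq {D M : ℝ} (hD : 0 < D) (hM : 0 < M) : 1 - alpha D M = M / (D + M) := by
  rw [alpha_eq hD hM]; field_simp; ring

lemma div_beta1_eq {β D M : ℝ} (hβ : 0 < β) (hD : 0 < D) (hM : 0 < M) :
    β / beta1 β D M = D / M := by
  rw [beta1, one_sub_alpha_eq hD hM, alpha_eq hD hM]; field_simp

lemma betaEff_eq {β D M : ℝ} (hβ : 0 < β) (hD : 0 < D) (hM : 0 < M) :
    betaEff β D M = (1 - alpha D M) * β := by
  rw [betaEff, beta1, one_sub_alpha_eq hD hM, alpha_eq hD hM]; field_simp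

/-! ### The residual reward of a policy -/

section Residual

variable {X : Type u} {A : Type v}

/-- The reward `β φ(π/π_ref) - c r̂` whose likelihood is maximized. -/
noncomputable def residual (γ β c : ℝ) (piRef : X → PMF A) (rHat : X → A → ℝ) (pol : X → PMF A)
    (x : X) (a : A) : ℝ :=
  β * phiRatio γ piRef pol x a - c * rHat x a

lemma gap_residual (γ β c : ℝ) (piRef : X → PMF A) (rHat : X → A → ℝ) (pol : X → PMF A)
    (x : X) (a b : A) : gap (residual γ β c piRef rHat pol) x a b =
      β * gap (phiRatio γ piRef pol) x a b - c * gap rHat x a b := by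
  simp only [gap, residual]; ring

lemma IsClosedForm.gap_eq {γ b : ℝ} {piRef : X → PMF A} {r : X → A → ℝ} {pol : X → PMF A}
    (h : IsClosedForm γ b piRef r pol) (x : X) (a a' : A) :
    b * gap (phiRatio γ piRef pol) x a a' = gap r x a a' := by
  obtain ⟨ζ, hζ⟩ := h
  have h1 := (hζ x a).2
  have h2 := (hζ x a').2
  simp only [gap]
  linarith

lemma gap_mix (α : ℝ) (r₁ r₂ : X → A → ℝ) (x : X) (a b : A) :
    gap (fun x a => (1 - α) * r₁ x a + α * r₂ x a) x a b =
      (1 - α) * gap r₁ x a b + α * gap r₂ x a b := by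
  simp only [gap]; ring

/-- The residual reward of the closed form solution is the latent reward. -/
lemma gap_residual_closedForm {γ β D M : ℝ} (hβ : 0 < β) (hD : 0 < D) (hM : 0 < M)
    {piRef : X → PMF A} {rStar r : X → A → ℝ} {pol : X → PMF A}
    (h : IsClosedForm γ (betaEff β D M) piRef
      (fun x a => (1 - alpha D M) * rStar x a + alpha D M * r x a) pol) (x : X) (a b : A) :
    gap (residual γ β (β / beta1 β D M) piRef r pol) x a b = gap rStar x a b := by
  have h1 := h.gap_eq x a b
  rw [gap_mix, betaEff_eq hβ hD hM, one_sub_alpha_eq hD hM, alpha_eq hD hM] at h1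
  rw [gap_residual, div_beta1_eq hβ hD hM]
  field_simp at h1 ⊢
  linarith

/-- Under realizability, the policy class is at least as large as the reward class. -/
lemma Realizable.card_le {γ b α : ℝ} (hα : α ≠ 0) {piRef : X → PMF A} {rStar : X → A → ℝ}
    {Rew : Finset (X → A → ℝ)} {Pol : Finset (X → PMF A)}
    (h : Realizable γ b α piRef rStar Rew Pol)
    (hinj : ∀ r₁ ∈ Rew, ∀ r₂ ∈ Rew, gap r₁ = gap r₂ → r₁ = r₂) : Rew.card ≤ Pol.card := by
  have : Nonempty (X → PMF A) := ⟨piRef⟩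
  choose! f hf hcl using h
  refine Finset.card_le_card_of_injOn f hf fun r₁ h₁ r₂ h₂ h12 => hinj _ h₁ _ h₂ ?_
  funext x a a'
  have e1 := (hcl r₁ h₁).gap_eq x a a'
  have e2 := (hcl r₂ h₂).gap_eq x a a'
  rw [h12, e2, gap_mix, gap_mix] at e1
  have : α * (gap r₁ x a a' - gap r₂ x a a') = 0 := by linarith
  rcases mul_eq_zero.1 this with h | h
  · exact absurd h hα
  · linarith

/-- Needed because γ is defined by a division by C⋆. -/
lemma conc_ne_zero {ν : PMF X} {pol piRef : X → PMF A} : conc ν piRef pol ≠ 0 := by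
  obtain ⟨x, hx⟩ := ν.support_nonempty
  obtain ⟨a, ha⟩ := (pol x).support_nonempty
  rw [PMF.mem_support_iff] at hx ha
  intro h
  have h1 := (mul_eq_zero.1 (ENNReal.tsum_eq_zero.1 h x)).resolve_left hx
  have h2 := (mul_eq_zero.1 (ENNReal.tsum_eq_zero.1 h1 a)).resolve_left ha
  rcases ENNReal.div_eq_zero_iff.1 h2 with h3 | h3
  · exact ha h3
  · exact PMF.apply_ne_top _ _ h3

lemma gap_abs_le {r : X → A → ℝ} {Rmin Rmax : ℝ} (h : ∀ x a, Rmin ≤ r x a ∧ r x a ≤ Rmax)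
    (x : X) (a b : A) : |gap r x a b| ≤ Rmax - Rmin := by
  have h1 := h x a
  have h2 := h x b
  exact abs_le.2 ⟨by rw [gap]; linarith, by rw [gap]; linarith⟩

lemma err_congr [MeasurableSpace X] [MeasurableSpace A] {ν : PMF X} {pol : X → PMF A}
    {rStar r : X → A → ℝ} (h : ∀ x a b, gap r x a b = gap rStar x a b) :
    err ν pol rStar r = 0 := by
  simp [err, h]

lemma sq_mix_le {α y z : ℝ} (h0 : 0 ≤ α) (h1 : 0 ≤ 1 - α) :
    ((1 - α) * y + α * z) ^ 2 ≤ (1 - α) * y ^ 2 + α * z ^ 2 := by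
  nlinarith [mul_nonneg (mul_nonneg h0 h1) (sq_nonneg (y - z))]

section Measurable

variable [Countable X] [Countable A] [MeasurableSpace X] [MeasurableSingletonClass X]
  [MeasurableSpace A] [MeasurableSingletonClass A]

/-- The error of the mixed reward is at most the mixture of the errors. -/
lemma mixed_error_le {ν : PMF X} {piData piRef pol : X → PMF A} {rStar rHat : X → A → ℝ}
    {γ β D M R : ℝ} (hβ : 0 < β) (hD : 0 < D) (hM : 0 < M)
    (hr : ∀ x a b, |gap rStar x a b| ≤ R) (hrHat : ∀ x a b, |gap rHat x a b| ≤ R)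
    (hres : ∀ x a b, |gap (residual γ β (β / beta1 β D M) piRef rHat pol) x a b| ≤ R)
    (herr : err ν piData rStar rHat ≤ M)
    (herr' : err ν piData rStar (residual γ β (β / beta1 β D M) piRef rHat pol) ≤ D) :
    ∫ p, gap (fun x a => rStar x a - betaEff β D M * phiRatio γ piRef pol x a)
      p.1 p.2.1 p.2.2 ^ 2 ∂(pairLaw ν piData).toMeasure ≤ 2 * D * M / (D + M) := by
  obtain ⟨h, hh⟩ : ∃ h, h = residual γ β (β / beta1 β D M) piRef rHat pol := ⟨_, rfl⟩
  rw [← hh] at hres herr'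
  have hα0 : 0 < alpha D M := by rw [alpha_eq hD hM]; positivity
  have hα1 : 0 < 1 - alpha D M := by rw [one_sub_alpha_eq hD hM]; positivity
  have hint : ∀ r : X → A → ℝ, (∀ x a b, |gap r x a b| ≤ R) →
      Integrable (fun p : X × A × A => (gap rStar p.1 p.2.1 p.2.2 - gap r p.1 p.2.1 p.2.2) ^ 2)
        (pairLaw ν piData).toMeasure := by
    intro r hr'
    refine integrable_of_abs_le (C := (2 * R) ^ 2) fun p => ?_
    rw [abs_pow]
    refine pow_le_pow_left₀ (abs_nonneg _) ((abs_sub _ _).trans ?_) 2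
    linarith [hr p.1 p.2.1 p.2.2, hr' p.1 p.2.1 p.2.2]
  have hpt : ∀ p : X × A × A,
      gap (fun x a => rStar x a - betaEff β D M * phiRatio γ piRef pol x a) p.1 p.2.1 p.2.2 ^ 2 ≤
      (1 - alpha D M) * (gap rStar p.1 p.2.1 p.2.2 - gap h p.1 p.2.1 p.2.2) ^ 2 +
        alpha D M * (gap rStar p.1 p.2.1 p.2.2 - gap rHat p.1 p.2.1 p.2.2) ^ 2 := by
    intro p
    have e1 : gap (fun x a => rStar x a - betaEff β D M * phiRatio γ piRef pol x a)
        p.1 p.2.1 p.2.2 = gap rStar p.1 p.2.1 p.2.2 -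
          betaEff β D M * gap (phiRatio γ piRef pol) p.1 p.2.1 p.2.2 := by
      simp only [gap]; ring
    -- This is the mixture identity β'φ = (1-α)h + αr̂ on gaps, as β' = (1-α)β and (1-α)β/β₁ = α.
    have e2 : (1 - alpha D M) * gap h p.1 p.2.1 p.2.2 =
        betaEff β D M * gap (phiRatio γ piRef pol) p.1 p.2.1 p.2.2 -
          alpha D M * gap rHat p.1 p.2.1 p.2.2 := by
      rw [hh, gap_residual, betaEff_eq hβ hD hM, div_beta1_eq hβ hD hM, one_sub_alpha_eq hD hM,
        alpha_eq hD hM]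
      field_simp
    rw [e1]
    have e3 : gap rStar p.1 p.2.1 p.2.2 -
        betaEff β D M * gap (phiRatio γ piRef pol) p.1 p.2.1 p.2.2 =
        (1 - alpha D M) * (gap rStar p.1 p.2.1 p.2.2 - gap h p.1 p.2.1 p.2.2) +
        alpha D M * (gap rStar p.1 p.2.1 p.2.2 - gap rHat p.1 p.2.1 p.2.2) := by
      linear_combination e2
    rw [e3]
    exact sq_mix_le hα0.le hα1.le
  have hi1 := (hint h hres).const_mul (1 - alpha D M)
  have hi2 := (hint rHat hrHat).const_mul (alpha D M)
  have heq := integral_add hi1 hi2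
  rw [integral_const_mul, integral_const_mul] at heq
  have hle := integral_mono_of_nonneg (Filter.Eventually.of_forall fun p => sq_nonneg _)
    (hi1.add hi2) (Filter.Eventually.of_forall hpt)
  refine (hle.trans_eq heq).trans ?_
  calc (1 - alpha D M) * err ν piData rStar h + alpha D M * err ν piData rStar rHat
      ≤ (1 - alpha D M) * D + alpha D M * M := by gcongr
    _ = _ := by
        rw [one_sub_alpha_eq hD hM, alpha_eq hD hM]; field_simp; ring

/-! ### The two random events -/

/-- The least squares solutions are accurate. -/
lemma rating_event_le {Ω : Type w} [MeasurableSpace Ω] {μ : Measure Ω}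
    (ν : PMF X) (piData : X → PMF A) {rStar : X → A → ℝ} {R V δ : ℝ} (hV : 0 < V) (hR : 0 ≤ R)
    (hδ : 0 < δ) (hδ1 : δ < 1) {N : ℕ} (hN : 0 < N) {Rew : Finset (X → A → ℝ)}
    {T : Fin N → Ω → (X × A × A) × ℝ} (hT : iIndepFun T μ)
    {κ : Fin N → Kernel (X × A × A) ℝ} [∀ j, IsMarkovKernel (κ j)]
    (hlaw : ∀ j, HasLaw (T j) ((pairLaw ν piData).toMeasure ⊗ₘ κ j) μ)
    (hsub : ∀ j x a b, IsUnbiasedSubgaussian V (gap rStar x a b) (κ j (x, a, b)))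
    (hr : ∀ x a b, |gap rStar x a b| ≤ R) (hRew : ∀ r ∈ Rew, ∀ x a b, |gap r x a b| ≤ R)
    (hmem : ∃ r ∈ Rew, gap r = gap rStar) :
    μ {ω | ∃ rHat, IsLeastSquares Rew (fun j => T j ω) rHat ∧
      errRat 1024 R V Rew.card δ N < err ν piData rStar rHat} ≤ ENNReal.ofReal (δ / 2) := by
  classical
  obtain ⟨r₀, hr₀, hgap₀⟩ := hmem
  have hcard : 0 < Rew.card := Finset.card_pos.2 ⟨r₀, hr₀⟩
  set M := errRat 1024 R V Rew.card δ N with hMdef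
  have hM : 0 < M := errRat_pos (by norm_num) hR hV hcard hN hδ hδ1
  set s : (X → A → ℝ) → Set Ω := fun r =>
    {ω | ∑ j, (gap r (T j ω).1.1 (T j ω).1.2.1 (T j ω).1.2.2 - (T j ω).2) ^ 2 ≤
        ∑ j, (gap rStar (T j ω).1.1 (T j ω).1.2.1 (T j ω).1.2.2 - (T j ω).2) ^ 2} with hs
  refine le_trans (measure_mono (t := ⋃ r ∈ Rew.filter fun r => M < err ν piData rStar r, s r)
    ?_) (measure_biUnion_le_half (n := Rew.card) (k := 1) hδ hδ1 ?_ ?_ ?_)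
  · rintro ω ⟨r, ⟨hrm, hmin⟩, hlt⟩
    refine Set.mem_biUnion (Finset.mem_coe.2 (Finset.mem_filter.2 ⟨hrm, hlt⟩)) ?_
    have := hmin r₀ hr₀
    rwa [hgap₀] at this
  · rw [pow_one]; exact Finset.card_filter_le _ _
  · rintro ⟨r, hrm⟩
    obtain ⟨hrm, hlt⟩ := Finset.mem_filter.1 hrm
    -- A bad reward differs from the realizing one, whose error is 0.
    refine Finset.one_lt_card.2 ⟨r, hrm, r₀, hr₀, ?_⟩
    rintro rfl
    rw [err_congr fun x a b => by rw [hgap₀]] at hlt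
    exact absurd hlt (not_lt.2 hM.le)
  · intro r hrm
    obtain ⟨hrm, hlt⟩ := Finset.mem_filter.1 hrm
    refine (rating_loss_le (R := R) ν piData hV hT hlaw hsub fun x a b =>
      (abs_sub _ _).trans ?_).trans
      (ENNReal.ofReal_le_ofReal (Real.exp_le_exp.2 (neg_le_neg ?_)))
    · linarith [hr x a b, hRew r hrm x a b]
    · have hB := add_sq_le_ratScale hR hV hN hδ hδ1
      have hL := log_card_div_pos hcard hδ hδ1
      have hVR : 0 < V + R ^ 2 := by positivity
      have hN' : (0 : ℝ) < N := by exact_mod_cast hN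
      -- 1024 = 2 · 2 · 256: two logarithms for the union bound, the factor 2 of
      -- `add_sq_le_ratScale`, and the rate of `rating_loss_le`.
      calc ((1 : ℕ) + 1 : ℝ) * Real.log (Rew.card / δ)
          = N * (1 / (256 * (V + R ^ 2)) *
            (1024 * ((V + R ^ 2) / 2) * Real.log (Rew.card / δ) / N)) := by
            field_simp; norm_num
        _ ≤ N * (1 / (256 * (V + R ^ 2)) * M) := by
            rw [hMdef, errRat]
            gcongr
        _ ≤ _ := by gcongr

/-- The maximum likelihood policies induce accurate residual rewards, uniformly over the
reward class. -/
lemma ranking_event_le {Ω : Type w} [MeasurableSpace Ω] {μ : Measure Ω}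
    (ν : PMF X) (piData piRef : X → PMF A) {rStar : X → A → ℝ} {γ β ρ Rmin Rmax δ M : ℝ}
    (hβ : 0 < β) (hρ : 0 < ρ) (hR : ρ ≤ Rmax) (hRmin : 0 ≤ Rmin) (hM : 0 < M)
    (hδ : 0 < δ) (hδ1 : δ < 1) {N : ℕ} (hN : 0 < N) {Rew : Finset (X → A → ℝ)}
    {Pol : Finset (X → PMF A)} (hPol : 0 < Pol.card)
    {S : Fin N → Ω → X × A × A} (hS : iIndepFun S μ)
    (hlaw : ∀ i, HasLaw (S i) (rankLaw ν piData rStar).toMeasure μ)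
    (hr : ∀ x a b, |gap rStar x a b| ≤ Rmax - Rmin)
    (hinj : ∀ r₁ ∈ Rew, ∀ r₂ ∈ Rew, gap r₁ = gap r₂ → r₁ = r₂) {D : ℝ}
    (hD : D = errDPO (192 / ρ ^ 2) Rmax Pol.card δ N)
    (hreal : Realizable γ (betaEff β D M) (alpha D M) piRef rStar Rew Pol) :
    μ {ω | ∃ rHat ∈ Rew, ∃ pOut, IsRDPOOutput γ β (beta1 β D M) piRef rHat
        (restricted γ β (beta1 β D M) Rmin Rmax piRef rHat Pol) (fun i => S i ω) pOut ∧
      D < err ν piData rStar (residual γ β (β / beta1 β D M) piRef rHat pOut)} ≤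
      ENNReal.ofReal (δ / 2) := by
  classical
  have hR0 : 0 < Rmax := hρ.trans_le hR
  have hD0 : 0 < D := hD ▸ errDPO_pos (by positivity) hR0 hPol hN hδ hδ1
  have hα : alpha D M ≠ 0 := by rw [alpha_eq hD0 hM]; positivity
  set c := β / beta1 β D M with hc
  set s : (X → A → ℝ) × (X → PMF A) → Set Ω := fun q =>
    {ω | ∑ i, Real.log (Real.sigmoid (gap rStar (S i ω).1 (S i ω).2.1 (S i ω).2.2)) ≤
        ∑ i, Real.log (Real.sigmoid (gap (residual γ β c piRef q.1 q.2)
          (S i ω).1 (S i ω).2.1 (S i ω).2.2))} with hs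
  -- The index set is deterministic: each possible r̂ is treated as fixed, hence its dependence on
  -- the ranking data is harmless.
  set bad := (Rew ×ˢ Pol).filter fun q =>
    q.2 ∈ restricted γ β (beta1 β D M) Rmin Rmax piRef q.1 Pol ∧
      D < err ν piData rStar (residual γ β c piRef q.1 q.2) with hbad
  refine le_trans (measure_mono (t := ⋃ q ∈ bad, s q) ?_)
    (measure_biUnion_le_half (n := Pol.card) (k := 2) hδ hδ1 ?_ ?_ ?_)
  · rintro ω ⟨rHat, hrm, pOut, ⟨hmax, hpm⟩, hlt⟩
    refine Set.mem_biUnion (x := (rHat, pOut)) (Finset.mem_coe.2 (Finset.mem_filter.2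
      ⟨Finset.mem_product.2 ⟨hrm, (Finset.mem_filter.1 hpm).1⟩, hpm, hlt⟩)) ?_
    -- The realizing policy for r̂ has the gaps of r⋆ as residual gaps. It therefore passes the
    -- restriction, and the maximizer must beat the likelihood of r⋆.
    obtain ⟨pol, hpol, hcl⟩ := hreal rHat hrm
    have hg := gap_residual_closedForm hβ hD0 hM hcl
    have hpol' : pol ∈ restricted γ β (beta1 β D M) Rmin Rmax piRef rHat Pol := by
      refine Finset.mem_filter.2 ⟨hpol, fun x a => ?_, fun x a b => ?_⟩
      · obtain ⟨ζ, hζ⟩ := hcl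
        exact (hζ x a).1
      · rw [← gap_residual, hg]
        exact hr x a b
    have := hmax hpol'
    simp only [Set.mem_ofPred_eq, ← gap_residual, hg] at this
    exact this
  · refine (Finset.card_filter_le _ _).trans ?_
    rw [Finset.card_product, sq]
    -- |R| ≤ |Π| bounds the number of pairs by |Π|², hence k = 2.
    exact Nat.mul_le_mul_right _ (hreal.card_le hα hinj)
  · rintro ⟨q, hq⟩
    obtain ⟨hqm, -, hlt⟩ := Finset.mem_filter.1 hq
    obtain ⟨hq1, hq2⟩ := Finset.mem_product.1 hqm
    obtain ⟨pol, hpol, hcl⟩ := hreal q.1 hq1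
    refine Finset.one_lt_card.2 ⟨q.2, hq2, pol, hpol, ?_⟩
    rintro rfl
    rw [err_congr (gap_residual_closedForm hβ hD0 hM hcl)] at hlt
    exact absurd hlt (not_lt.2 hD0.le)
  · intro q hq
    obtain ⟨hqm, hq', hlt⟩ := Finset.mem_filter.1 hq
    refine (rank_likelihood_le (R := Rmax) ν piData hS hlaw (fun x a b => ?_)
      fun x a b => ?_).trans (ENNReal.ofReal_le_ofReal (Real.exp_le_exp.2 (neg_le_neg ?_)))
    · linarith [hr x a b]
    · rw [gap_residual]
      linarith [(Finset.mem_filter.1 hq').2.2 x a b]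
    · have hL := log_card_div_pos hPol hδ hδ1
      have hN' : (0 : ℝ) < N := by exact_mod_cast hN
      have h1 : 1 ≤ Real.exp (2 * Rmax) := Real.one_le_exp (by positivity)
      have h2 : Real.exp (-(2 * Rmax)) * Real.exp (4 * Rmax) = Real.exp (2 * Rmax) := by
        rw [← Real.exp_add]; congr 1; ring
      -- 192 = 3 · 64: three logarithms and the rate e^{-2R}/64. The factor R_max² of D is only
      -- bounded below by ρ², whence the division by ρ².
      calc ((2 : ℕ) + 1 : ℝ) * Real.log (Pol.card / δ)
          ≤ 3 * (Rmax ^ 2 / ρ ^ 2) * Real.exp (2 * Rmax) * Real.log (Pol.card / δ) := by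
            have h3 : 1 ≤ Rmax ^ 2 / ρ ^ 2 := by
              rw [one_le_div (by positivity)]
              exact pow_le_pow_left₀ hρ.le hR 2
            gcongr
            push_cast
            nlinarith
        _ = N * (Real.exp (-(2 * Rmax)) / 64 * D) := by
            rw [hD, errDPO, ← h2]
            field_simp
            ring
        _ ≤ _ := by gcongr

end Measurable

end Residual

/-! ### Deterministic suboptimality -/

section Deterministic

variable {X : Type u} {A : Type v} [Countable X] [Countable A] [MeasurableSpace X]
  [MeasurableSingletonClass X] [MeasurableSpace A] [MeasurableSingletonClass A]

/-- The regret of a member of the restricted class in terms of the two reward errors. -/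
lemma regret_le {ν : PMF X} {piRef piData pStar pOut : X → PMF A} {rStar rHat : X → A → ℝ}
    {γ β D M Rmin Rmax : ℝ} {Pol : Finset (X → PMF A)} (hγ : 0 ≤ γ) (hβ : 0 < β) (hD : 0 < D)
    (hM : 0 < M) (href : ∀ x a, piRef x a ≠ 0) (hRmin : 0 ≤ Rmin)
    (hr : ∀ x a, Rmin ≤ rStar x a ∧ rStar x a ≤ Rmax)
    (hrHat : ∀ x a b, |gap rHat x a b| ≤ Rmax - Rmin)
    (hpOut : pOut ∈ restricted γ β (beta1 β D M) Rmin Rmax piRef rHat Pol)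
    (herr : err ν piData rStar rHat ≤ M)
    (herr' : err ν piData rStar (residual γ β (β / beta1 β D M) piRef rHat pOut) ≤ D)
    (hstar : conc ν piData pStar ≠ ⊤) (hγ' : γ = 0 ∧ conc ν piData pOut ≠ ⊤ ∨ piData = piRef) :
    objective ν piRef (betaEff β D M) rStar pStar - objective ν piRef (betaEff β D M) rStar pOut ≤
      ((√((conc ν piData pStar).toReal * (2 * D * M / (D + M))) +
        √((conc ν piData pOut).toReal * (2 * D * M / (D + M))) +
        betaEff β D M * γ / 2 *
          ((conc ν piData pStar).toReal - (conc ν piData pOut).toReal) : ℝ) : EReal) := by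
  classical
  obtain ⟨-, hpos, hres⟩ := Finset.mem_filter.1 hpOut
  have hgapR := gap_abs_le hr
  have hb : 0 < betaEff β D M := by
    rw [betaEff_eq hβ hD hM, one_sub_alpha_eq hD hM]; positivity
  have hc : 0 < β / beta1 β D M := by rw [div_beta1_eq hβ hD hM]; positivity
  -- The restriction to Π' bounds the induced reward of π_out, hence its ratio to π_ref; this makes
  -- its divergence, and for π_data = π_ref its concentrability, finite.
  have hG : ∀ x a b, |gap (phiRatio γ piRef pOut) x a b| ≤
      ((Rmax - Rmin) + β / beta1 β D M * (Rmax - Rmin)) / β := by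
    intro x a b
    rw [le_div_iff₀ hβ, mul_comm, ← abs_of_pos hβ, ← abs_mul, abs_of_pos hβ]
    have h1 := hres x a b
    have h2 := mul_le_mul_of_nonneg_left (hrHat x a b) hc.le
    have h3 : |β / beta1 β D M * gap rHat x a b| = β / beta1 β D M * |gap rHat x a b| := by
      rw [abs_mul, abs_of_pos hc]
    have h4 := abs_add_le (β * gap (phiRatio γ piRef pOut) x a b -
      β / beta1 β D M * gap rHat x a b) (β / beta1 β D M * gap rHat x a b)
    rw [sub_add_cancel] at h4
    linarith
  have hE := mixed_error_le (γ := γ) (piRef := piRef) (pol := pOut) hβ hD hM hgapR hrHat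
    (fun x a b => by rw [gap_residual]; exact hres x a b) herr herr'
  have hrb : ∀ x a, |rStar x a| ≤ Rmax := fun x a =>
    abs_le.2 ⟨by linarith [(hr x a).1, (hr x a).2], (hr x a).2⟩
  have hout : conc ν piData pOut ≠ ⊤ := by
    rcases hγ' with h | h
    · exact h.2
    · rw [h]
      exact conc_ne_top href fun p => ratio_le_exp hγ (href p.1 p.2) (hpos p.1 p.2)
        (abs_phiRatio_le hγ href hpos hG p.1 p.2)
  exact objective_sub_le hγ hb href hpos hrb hG hE hstar hout (hγ'.imp_left And.left)

end Deterministic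

/-! ### Eliminating the concentrability of the output policy -/

/-- With E = g²C, AM-GM gives √(Co·E) = g√(Co·C) ≤ g(Co+C)/2, and the penalty -g·Co/2 cancels the
part that depends on Co. The sum is then 2gC = 2√(C·E). -/
lemma sqrt_add_sqrt_add_le {C Co E g : ℝ} (hC : 0 < C) (hCo : 0 ≤ Co) (hE : 0 ≤ E)
    (hg : g = √(E / C)) :
    √(C * E) + √(Co * E) + g / 2 * (C - Co) ≤ 2 * √(C * E) := by
  have hg0 : 0 ≤ g := hg ▸ Real.sqrt_nonneg _
  have hEg : E = g ^ 2 * C := by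
    rw [hg, Real.sq_sqrt (by positivity)]; field_simp
  have h1 : √(C * E) = C * g := by
    rw [hEg, show C * (g ^ 2 * C) = (C * g) ^ 2 by ring, Real.sqrt_sq (by positivity)]
  have h2 : √(Co * E) ≤ g * (Co + C) / 2 := by
    refine Real.sqrt_le_iff.2 ⟨by positivity, ?_⟩
    rw [hEg]
    nlinarith [mul_nonneg (sq_nonneg g) (sq_nonneg (Co - C))]
  rw [h1]
  linarith

/-- γ is normalized so that the effective χ² weight β'γ is the g of `sqrt_add_sqrt_add_le`. -/
lemma betaEff_mul_gammaChi {β D M C : ℝ} (hβ : 0 < β) (hD : 0 < D) (hM : 0 < M) :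
    betaEff β D M * gammaChi β D M C = √(2 * D * M / (D + M) / C) := by
  have hb : 0 < betaEff β D M := by
    rw [betaEff_eq hβ hD hM, one_sub_alpha_eq hD hM]; positivity
  have h1 : β ^ 2 * (1 - alpha D M) ^ 2 = betaEff β D M ^ 2 := by
    rw [betaEff_eq hβ hD hM]; ring
  rw [gammaChi, h1, ← div_div, div_right_comm, Real.sqrt_div' _ (sq_nonneg _),
    Real.sqrt_sq hb.le, mul_div_cancel₀ _ hb.ne']

end RDPO

/-! ### Assembly of the theorem -/

theorem mainTheorem5 :
    ∃ c₂ : ℝ, 0 < c₂ ∧ ∀ ρ : ℝ, 0 < ρ → ∃ c₁ K : ℝ, 0 < c₁ ∧ 0 < K ∧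
    ∀ (X : Type u) (A : Type v) [Countable X] [Countable A]
      [MeasurableSpace X] [MeasurableSingletonClass X]
      [MeasurableSpace A] [MeasurableSingletonClass A]
      -- prompt distribution, policies, latent reward and its range
      (ν : PMF X) (piRef piData : X → PMF A) (rStar : X → A → ℝ) (Rmin Rmax : ℝ)
      -- finite policy class and finite reward class
      (Pol : Finset (X → PMF A)) (Rew : Finset (X → A → ℝ))
      -- subgaussian parameter, regularization, confidence, sample sizes
      (V β δ : ℝ) (Nrank Nrat : ℕ)
      -- the ranking data `S` and the rating data `T`, with rating gap kernels `κ`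
      (Ω : Type w) [MeasurableSpace Ω] (μ : Measure Ω) [IsProbabilityMeasure μ]
      (S : Fin Nrank → Ω → X × A × A) (T : Fin Nrat → Ω → (X × A × A) × ℝ)
      (κ : Fin Nrat → Kernel (X × A × A) ℝ) [∀ j, IsMarkovKernel (κ j)],
      ρ ≤ Rmax → 0 ≤ Rmin → (∀ x a, Rmin ≤ rStar x a ∧ rStar x a ≤ Rmax) →
      (∀ x a, piRef x a ≠ 0) →
      (∀ r ∈ Rew, ∀ x a b, |RDPO.gap r x a b| ≤ Rmax - Rmin) →
      (∃ r ∈ Rew, RDPO.gap r = RDPO.gap rStar) →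
      (∀ r₁ ∈ Rew, ∀ r₂ ∈ Rew, RDPO.gap r₁ = RDPO.gap r₂ → r₁ = r₂) →
      0 < V → 0 < β → 0 < δ → δ < 1 → 0 < Nrank → 0 < Nrat →
      iIndepFun S μ →
      (∀ i, HasLaw (S i) (RDPO.rankLaw ν piData rStar).toMeasure μ) →
      iIndepFun T μ →
      (∀ j, HasLaw (T j) ((RDPO.pairLaw ν piData).toMeasure ⊗ₘ κ j) μ) →
      (∀ j x a b, RDPO.IsUnbiasedSubgaussian V (RDPO.gap rStar x a b) (κ j (x, a, b))) →
      let D : ℝ := RDPO.errDPO c₁ Rmax Pol.card δ Nrank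
      let M : ℝ := RDPO.errRat c₂ Rmax V Rew.card δ Nrat
      let α : ℝ := RDPO.alpha D M
      let β₁ : ℝ := RDPO.beta1 β D M
      let β' : ℝ := RDPO.betaEff β D M
      -- the rating regression
      (ENNReal.ofReal (1 - δ) ≤ μ {ω | ∀ rHat : X → A → ℝ,
        RDPO.IsLeastSquares Rew (fun j => T j ω) rHat → RDPO.err ν piData rStar rHat ≤ M}) ∧
      -- `χ²` regularization, with `π_data = π_ref`
      (piData = piRef → ∀ pStar ∈ Pol, RDPO.conc ν piRef pStar ≠ ⊤ →
        let CStar : ℝ := (RDPO.conc ν piRef pStar).toReal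
        let γ : ℝ := RDPO.gammaChi β D M CStar
        RDPO.Realizable γ β' α piRef rStar Rew Pol →
        ENNReal.ofReal (1 - δ) ≤ μ {ω | ∀ (rHat : X → A → ℝ) (pOut : X → PMF A),
          let Pol' := RDPO.restricted γ β β₁ Rmin Rmax piRef rHat Pol
          RDPO.IsLeastSquares Rew (fun j => T j ω) rHat →
          RDPO.IsRDPOOutput γ β β₁ piRef rHat Pol' (fun i => S i ω) pOut →
          RDPO.err ν piRef rStar rHat ≤ M ∧
          RDPO.SuboptBounds K CStar D M Rmax V δ Nrank Nrat Rew.card Pol.card Pol'.card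
            (RDPO.objective ν piRef β' rStar pStar - RDPO.objective ν piRef β' rStar pOut)}) ∧
      -- `γ = 0`, with arbitrary `π_data`
      (RDPO.concMax ν piData Pol ≠ ⊤ →
        let CMax : ℝ := (RDPO.concMax ν piData Pol).toReal
        RDPO.Realizable 0 β' α piRef rStar Rew Pol →
        ENNReal.ofReal (1 - δ) ≤ μ {ω | ∀ (rHat : X → A → ℝ) (pOut : X → PMF A),
          let Pol' := RDPO.restricted 0 β β₁ Rmin Rmax piRef rHat Pol
          RDPO.IsLeastSquares Rew (fun j => T j ω) rHat →
          RDPO.IsRDPOOutput 0 β β₁ piRef rHat Pol' (fun i => S i ω) pOut →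
          RDPO.err ν piData rStar rHat ≤ M ∧
          ∀ pStar ∈ Pol,
            RDPO.SuboptBounds K CMax D M Rmax V δ Nrank Nrat Rew.card Pol.card Pol'.card
              (RDPO.objective ν piRef β' rStar pStar
                - RDPO.objective ν piRef β' rStar pOut)}) := by
  refine ⟨1024, by norm_num, fun ρ hρ => ⟨192 / ρ ^ 2, 4 * (1 + √(max (192 / ρ ^ 2) 1024)),
    by positivity, by positivity, ?_⟩⟩
  intro X A _ _ _ _ _ _ ν piRef piData rStar Rmin Rmax Pol Rew V β δ Nrank Nrat Ω _ μ _ S T κ _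
    hR hRmin hr href hRew hmem hinj hV hβ hδ hδ1 hNrank hNrat hS hSlaw hT hTlaw hsub D M α β₁ β'
  have hR0 : 0 < Rmax := hρ.trans_le hR
  have hc₁ : 0 < 192 / ρ ^ 2 := by positivity
  have hgapR := RDPO.gap_abs_le hr
  have hcard : 0 < Rew.card := let ⟨r, hr, _⟩ := hmem; Finset.card_pos.2 ⟨r, hr⟩
  have hM : 0 < M := RDPO.errRat_pos (by norm_num) hR0.le hV hcard hNrat hδ hδ1
  have hrating := RDPO.rating_event_le (μ := μ) ν piData hV hR0.le hδ hδ1 hNrat hT hTlaw hsub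
    (fun x a b => (hgapR x a b).trans (by linarith))
    (fun r hr x a b => (hRew r hr x a b).trans (by linarith)) hmem
  have hPol : ∀ {γ : ℝ}, RDPO.Realizable γ β' α piRef rStar Rew Pol → 0 < Pol.card := by
    intro γ hreal
    obtain ⟨r, hr, _⟩ := hmem
    obtain ⟨pol, hpol, _⟩ := hreal r hr
    exact Finset.card_pos.2 ⟨pol, hpol⟩
  -- Each data set fails with probability at most δ/2; the union bound needs no joint law of the
  -- two.
  have hboth : ∀ {γ : ℝ} {good : Set Ω}, RDPO.Realizable γ β' α piRef rStar Rew Pol →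
      (∀ ω, (∀ rHat, RDPO.IsLeastSquares Rew (fun j => T j ω) rHat →
          RDPO.err ν piData rStar rHat ≤ M) →
        (∀ rHat ∈ Rew, ∀ pOut, RDPO.IsRDPOOutput γ β β₁ piRef rHat
          (RDPO.restricted γ β β₁ Rmin Rmax piRef rHat Pol) (fun i => S i ω) pOut →
          RDPO.err ν piData rStar (RDPO.residual γ β (β / β₁) piRef rHat pOut) ≤ D) →
        ω ∈ good) → ENNReal.ofReal (1 - δ) ≤ μ good := by
    intro γ good hreal hgood
    have hranking := RDPO.ranking_event_le (μ := μ) ν piData piRef hβ hρ hR hRmin hM hδ hδ1 hNrank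
      (hPol hreal) hS hSlaw hgapR hinj (D := D) rfl hreal
    refine RDPO.one_sub_le_measure hδ.le (fun ω hω => ?_) ((measure_union_le _ _).trans
      ((add_le_add hrating hranking).trans_eq ?_))
    · simp only [Set.mem_union, not_or, Set.mem_ofPred_eq, not_exists, not_and, not_lt] at hω
      exact hgood ω hω.1 hω.2
    · rw [← ENNReal.ofReal_add (by positivity) (by positivity), add_halves]
  refine ⟨?_, ?_, ?_⟩
  · refine RDPO.one_sub_le_measure hδ.le (fun ω hω => ?_)
      (hrating.trans (ENNReal.ofReal_le_ofReal (by linarith)))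
    simpa only [Set.mem_ofPred_eq, not_exists, not_and, not_lt] using hω
  · intro hdata pStar hpStar hconc CStar γ hreal
    have hD : 0 < D := RDPO.errDPO_pos hc₁ hR0 (hPol hreal) hNrank hδ hδ1
    refine hboth hreal fun ω h1 h2 rHat pOut hLS hout => ?_
    have herr := h1 rHat hLS
    refine ⟨hdata ▸ herr, ?_⟩
    have hC : 0 < CStar := ENNReal.toReal_pos RDPO.conc_ne_zero hconc
    refine RDPO.suboptBounds_of_le hc₁ (by norm_num) hR0 hV hδ hδ1 hC.le hNrank hNrat hcard
      (hPol hreal) rfl rfl ?_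
    have hreg := RDPO.regret_le (pStar := pStar) (Real.sqrt_nonneg _) hβ hD hM href hRmin hr
      (hRew rHat hLS.1) hout.2 herr (h2 rHat hLS.1 pOut hout) (hdata ▸ hconc) (Or.inr hdata)
    rw [hdata] at hreg
    refine hreg.trans (EReal.coe_le_coe_iff.2 ?_)
    exact RDPO.sqrt_add_sqrt_add_le hC ENNReal.toReal_nonneg (by positivity)
      (RDPO.betaEff_mul_gammaChi hβ hD hM)
  · intro hconc CMax hreal
    have hD : 0 < D := RDPO.errDPO_pos hc₁ hR0 (hPol hreal) hNrank hδ hδ1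
    refine hboth hreal fun ω h1 h2 rHat pOut hLS hout => ?_
    have herr := h1 rHat hLS
    refine ⟨herr, fun pStar hpStar => ?_⟩
    refine RDPO.suboptBounds_of_le hc₁ (by norm_num) hR0 hV hδ hδ1 ENNReal.toReal_nonneg hNrank
      hNrat hcard (hPol hreal) rfl rfl ?_
    have hle : ∀ pol ∈ Pol, RDPO.conc ν piData pol ≤ RDPO.concMax ν piData Pol := fun pol h =>
      Finset.le_sup (f := RDPO.conc ν piData) h
    have hpOut : pOut ∈ Pol := by classical exact (Finset.mem_filter.1 hout.2).1
    have hreg := RDPO.regret_le (pStar := pStar) le_rfl hβ hD hM href hRmin hr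
      (hRew rHat hLS.1) hout.2 herr (h2 rHat hLS.1 pOut hout)
      (ne_top_of_le_ne_top hconc (hle _ hpStar))
      -- The output lies in Π, so C^max controls its concentrability as well as that of the
      -- comparator.
      (Or.inl ⟨rfl, ne_top_of_le_ne_top hconc (hle _ hpOut)⟩)
    refine hreg.trans (EReal.coe_le_coe_iff.2 ?_)
    have hsqrt : ∀ pol ∈ Pol, √((RDPO.conc ν piData pol).toReal * (2 * D * M / (D + M))) ≤
        √(CMax * (2 * D * M / (D + M))) := fun pol h =>
      Real.sqrt_le_sqrt (mul_le_mul_of_nonneg_right (ENNReal.toReal_mono hconc (hle _ h))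
        (by positivity))
    have e1 := hsqrt _ hpStar
    have e2 := hsqrt _ hpOut
    simp only [mul_zero, zero_div, zero_mul, add_zero]
    linarith
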